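/- Let $R>0$ and let $S_R\subset\mathbb C^3$ be the sphere of radius $R$ about the origin, where $\mathbb C^3$ carries the Hermitian product $\langle a|b\rangle=\sum\bar a_ib_i$ and the Euclidean product $\operatorname{Re}\langle a|b\rangle$. Let $T$ be a connected smooth real surface and $r:T\to S_R$ a smooth immersion that is *complexly normal*: at each point the unit normal $N=r/R$ of $S_R$ is orthogonal to the tangent plane of $T$ in the Hermitian product. In local coordinates $x^1,x^2$ put $E_i=\partial_ir$, $\langle E_i|E_j\rangle=g_{ij}+i\,\omega_{ij}$, $F_i=iE_i+\sum_{s,k} g^{sk}\omega_{ki}E_s$, let $\Gamma^k_{ij}$ be the Christoffel symbols of $g$, and let $T^k_{ij}$ be the coefficients of $F_k$ in the expansion $\partial_iE_j=\sum\Gamma^k_{ij}E_k+\sum T^k_{ij}F_k+(b_{ij}+i\,d_{ij})N$. Assume that $r$ has zero mean curvature in $S_R$: $\sum g^{ij}T^k_{ij}F_k=0$. Indices of $T^k_{ij}$ are lowered and raised with $g$, $T_{kij}=\sum_s g_{sk}T^s_{ij}$. Call coordinates $z=x+iy$, $x=x^1$, $y=x^2$, *isothermal* if $g=2R^2e^u\,dz\,d\bar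 z$ with a real function $u$, and put $A=T^1_{11}$, $B=T^2_{22}$, $G=e^u(A+iB)$. 1. In any isothermal coordinates $F_k=iE_k$, $\partial_iE_j=\sum\Gamma^k_{ij}E_k+\sum T^k_{ij}F_k-\frac1R g_{ij}N$, and $$T^1_{11}=A,\quad T^2_{12}=T^2_{21}=T^1_{22}=-A,\quad T^2_{22}=B,\quad T^1_{12}=T^1_{21}=T^2_{11}=-B.\qquad(*)$$ The Peterson–Codazzi–Ricci equation $\nabla_iT_{jsk}-\nabla_jT_{isk}=0$ and the Gauss equation $$R^s_{kij}=\sum_r T^r_{jk}T^s_{ir}-\sum_r T^r_{ik}T^s_{jr}+\frac{g_{jk}\delta^s_i-g_{ik}\delta^s_j}{R^2}$$ hold, where $R^s_{kij}=\partial_i\Gamma^s_{kj}-\partial_j\Gamma^s_{ki}-\sum_r\Gamma^r_{ki}\Gamma^s_{rj}+\sum_r\Gamma^r_{kj}\Gamma^s_{ri}$. The function $G$ is holomorphic. Moreover, for any smooth real functions $u,A,B$ on an open set of the plane, with the metric $g=2R^2e^u\,dz\,d\bar z$ and the tensor $(*)$, the Peterson–Codazzi–Ricci equation is equivalent to $\partial_x(e^uA)=\partial_y(e^uB)$,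 $\partial_y(e^uA)=-\partial_x(e^uB)$, i.e. to holomorphy of $e^u(A+iB)$. 2. If $G\equiv0$, i.e. each point of $T$ lies in the domain of isothermal coordinates in which $G$ vanishes identically, then $T$ is a piece of a great 2-sphere: there is a real 3-dimensional subspace $V\subset\mathbb C^3$ such that $r(T)$ is a relatively open subset of $V\cap S_R$. 3. Let $T$ be a torus with an isothermal uniformizing parameter $z$ on its universal cover, that is, let $p:\mathbb C\to T$ be a surjective local diffeomorphism with $p(z)=p(w)$ iff $z-w\in\mathbb Z\omega_1+\mathbb Z\omega_2$, where $\omega_1,\omega_2\in\mathbb C$ are linearly independent over $\mathbb R$, such that the metric in the coordinate $z$ is $2R^2e^u\,dz\,d\bar z$ on all of $\mathbb C$. Suppose $G\not\equiv0$ on $\mathbb C$. Then $G$ is a nonzero constant, and there is $c>0$ such that for the rescaled parameter $p(cz)$, with $u(cz)+2\log c$ in place of $u$ and periods $\omega_1/c$, $\omega_2/c$, one has $|G|\equiv1$. If $|G|\equiv1$, then there is a constant $\vartheta\in\mathbb R$ with $G=\cos\vartheta+i\sin\vartheta$ and $$T^1_{11}=-T^1_{22}=-T^2_{12}=-T^2_{21}=e^{-u}\cos\vartheta,\qquad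 T^2_{22}=-T^2_{11}=-T^1_{12}=-T^1_{21}=e^{-u}\sin\vartheta;\qquad(**)$$ the invariants $k=\sum T^{ijs}T_{ijs}$ and $q=\sum T^i_{jk}T^{jk}_sT^s_{rp}T^{rp}_i$ are $$k=\frac{2e^{-3u}}{R^2},\qquad q=\frac{2e^{-6u}}{R^4};$$ and $u$ is smooth, doubly periodic with periods $\omega_1,\omega_2$, and satisfies the Tzitzeica equation $$u_{xx}+u_{yy}=4e^{-2u}-4e^u,\qquad\text{i.e.}\qquad u_{z\bar z}=e^{-2u}-e^u,$$ where $\partial_z=\frac12(\partial_x-i\partial_y)$ and $\partial_{\bar z}=\frac12(\partial_x+i\partial_y)$. Moreover, for any smooth real $u$ on an open set of the plane and any real constant $\vartheta$, the Gauss equation for the metric $2R^2e^u\,dz\,d\bar z$ and the tensor $(**)$ is equivalent to this equation. -/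

import Mathlib

open scoped Manifold ContDiff

noncomputable section

/-- The Hermitian space `ℂ³`; `inner ℂ a b = ∑ conj (a i) * b i`. -/
abbrev C3 : Type := EuclideanSpace ℂ (Fin 3)

/-- The coordinate directions `∂/∂x` and `∂/∂y` of the plane `ℂ` of the variable `z = x + i y`. -/
def coordDir : Fin 2 → ℂ := ![1, Complex.I]

/-- The partial derivative `∂ᵢ f` with respect to `x¹ = Re z`, `x² = Im z`
(the indices `1, 2` are written `0, 1`). -/
def pd {F : Type*} [NormedAddCommGroup F] [NormedSpace ℝ F] (i : Fin 2) (f : ℂ → F) (z : ℂ) : F :=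
  fderiv ℝ f z (coordDir i)

/-- The Wirtinger derivative `∂f/∂z`. -/
def wirtinger (f : ℂ → ℂ) (z : ℂ) : ℂ := (pd 0 f z - Complex.I * pd 1 f z) / 2

/-- The Wirtinger derivative `∂f/∂z̄`. -/
def wirtingerBar (f : ℂ → ℂ) (z : ℂ) : ℂ := (pd 0 f z + Complex.I * pd 1 f z) / 2

/-! Tensor calculus for a metric `g` and a tensor `t k i j z = Tᵏᵢⱼ(z)` on a domain of the plane. -/

/-- A field of `2 × 2` matrices `g_{ij}`. -/
abbrev MetricField : Type := ℂ → Matrix (Fin 2) (Fin 2) ℝ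

/-- A field with components `Tᵏᵢⱼ` or `T_{kij}`, in this order of indices. -/
abbrev Tensor3 : Type := Fin 2 → Fin 2 → Fin 2 → ℂ → ℝ

/-- The components `Γᵏᵢⱼ` of the metric connection. -/
def christoffel (g : MetricField) (k i j : Fin 2) (z : ℂ) : ℝ :=
  ∑ s, (g z)⁻¹ k s / 2 *
    (pd i (fun w => g w s j) z + pd j (fun w => g w i s) z - pd s (fun w => g w i j) z)

/-- The Riemann curvature tensor `Rˢₖᵢⱼ`. -/
def riemann (g : MetricField) (s k i j : Fin 2) (z : ℂ) : ℝ :=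
  pd i (christoffel g s k j) z - pd j (christoffel g s k i) z
    - ∑ r, christoffel g r k i z * christoffel g s r j z
    + ∑ r, christoffel g r k j z * christoffel g s r i z

/-- `T_{kij} = ∑ₛ Tˢᵢⱼ g_{sk}`. -/
def lowerIndex (g : MetricField) (t : Tensor3) : Tensor3 :=
  fun k i j z => ∑ s, t s i j z * g z s k

/-- The covariant derivative `∇ᵢ S_{jsk}` of a tensor with three lower indices. -/
def covDeriv (g : MetricField) (S : Tensor3) (i j s k : Fin 2) (z : ℂ) : ℝ :=
  pd i (S j s k) z - ∑ r, (christoffel g r i j z * S r s k z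
    + christoffel g r i s z * S j r k z + christoffel g r i k z * S j s r z)

/-- The Peterson–Codazzi–Ricci equation `∇ᵢ T_{jsk} - ∇ⱼ T_{isk} = 0` on `D`. -/
def CodazziRicciEq (g : MetricField) (t : Tensor3) (D : Set ℂ) : Prop :=
  ∀ z ∈ D, ∀ i j s k : Fin 2,
    covDeriv g (lowerIndex g t) i j s k z - covDeriv g (lowerIndex g t) j i s k z = 0

/-- The Gauss equation
`Rˢₖᵢⱼ = ∑ᵣ Tʳⱼₖ Tˢᵢᵣ - ∑ᵣ Tʳᵢₖ Tˢⱼᵣ + (g_{jk} δˢᵢ - g_{ik} δˢⱼ) / R²` on `D`. -/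
def GaussEq (R : ℝ) (g : MetricField) (t : Tensor3) (D : Set ℂ) : Prop :=
  ∀ z ∈ D, ∀ s k i j : Fin 2,
    riemann g s k i j z =
      (∑ r, t r j k z * t s i r z) - (∑ r, t r i k z * t s j r z)
        + (g z j k * (if s = i then 1 else 0) - g z i k * (if s = j then 1 else 0)) / R ^ 2

/-- The scalar invariant `k = ∑ T^{ijs} T_{ijs}`. -/
def invariantK (g : MetricField) (t : Tensor3) (z : ℂ) : ℝ :=
  ∑ i, ∑ j, ∑ s,
    (∑ a, ∑ b, ∑ c, (g z)⁻¹ i a * (g z)⁻¹ j b * (g z)⁻¹ s c * lowerIndex g t a b c z)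
      * lowerIndex g t i j s z

/-- `T^{jk}ₛ`, both upper indices being obtained by raising. -/
def raiseTwo (g : MetricField) (t : Tensor3) (j k s : Fin 2) (z : ℂ) : ℝ :=
  ∑ a, ∑ b, (g z)⁻¹ j a * (g z)⁻¹ k b * lowerIndex g t a b s z

/-- The scalar invariant `q = ∑ Tⁱⱼₖ T^{jk}ₛ Tˢᵣₚ T^{rp}ᵢ`. -/
def invariantQ (g : MetricField) (t : Tensor3) (z : ℂ) : ℝ :=
  ∑ i, ∑ j, ∑ k, ∑ r, ∑ p, ∑ s,
    t i j k z * raiseTwo g t j k s z * t s r p z * raiseTwo g t r p i z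

/-- The conformally Euclidean metric `2 R² eᵘ dz dz̄ = 2 R² eᵘ (dx² + dy²)`. -/
def confMetric (R : ℝ) (u : ℂ → ℝ) : MetricField :=
  fun z => (2 * R ^ 2 * Real.exp (u z)) • (1 : Matrix (Fin 2) (Fin 2) ℝ)

/-- The tensor with `T¹₁₁ = A`, `T²₁₂ = T²₂₁ = T¹₂₂ = -A`, `T²₂₂ = B`,
`T¹₁₂ = T¹₂₁ = T²₁₁ = -B`. -/
def traceFreeTensor (A B : ℂ → ℝ) : Tensor3 := fun k i j z =>
  (![!![A z, -B z; -B z, -A z], !![-B z, -A z; -A z, B z]] : Fin 2 → Matrix (Fin 2) (Fin 2) ℝ) k i j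

/-! Geometry of a surface given by a parametrization `ρ(x¹, x²)` with values in `ℂ³`. -/

/-- The basic tangent vectors `Eᵢ = ∂ᵢ ρ`. -/
def tangentVec (ρ : ℂ → C3) (i : Fin 2) (z : ℂ) : C3 := pd i ρ z

/-- The induced Riemannian metric, the real part of the Hermitian metric `⟨Eᵢ | Eⱼ⟩`. -/
def inducedMetric (ρ : ℂ → C3) : MetricField := fun z =>
  Matrix.of fun i j => (inner ℂ (tangentVec ρ i z) (tangentVec ρ j z)).re

/-- The imaginary part `ω_{ij}` of the Hermitian metric `⟨Eᵢ | Eⱼ⟩`. -/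
def inducedOmega (ρ : ℂ → C3) : MetricField := fun z =>
  Matrix.of fun i j => (inner ℂ (tangentVec ρ i z) (tangentVec ρ j z)).im

/-- The vectors `Fᵢ = i Eᵢ + ∑ₛ Ωˢᵢ Eₛ`, `Ω = g⁻¹ ω`: they are orthogonal to `E₁`, `E₂` in the
Euclidean metric. -/
def complVec (ρ : ℂ → C3) (i : Fin 2) (z : ℂ) : C3 :=
  Complex.I • tangentVec ρ i z
    + ∑ s, ((inducedMetric ρ z)⁻¹ * inducedOmega ρ z) s i • tangentVec ρ s z

/-- The Gram matrix of `F₁`, `F₂` in the Euclidean metric. -/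
def complGram (ρ : ℂ → C3) : MetricField := fun z =>
  Matrix.of fun i j => (inner ℂ (complVec ρ i z) (complVec ρ j z)).re

/-- The coefficients `Tᵏᵢⱼ` in
`∂ᵢ Eⱼ = ∑ₖ Γᵏᵢⱼ Eₖ + ∑ₖ Tᵏᵢⱼ Fₖ + (b_{ij} + i d_{ij}) N`, extracted by pairing with the
vectors `F₁`, `F₂`, which are Euclidean orthogonal to `E₁`, `E₂`, `N`, `i N`. -/
def shapeTensor (ρ : ℂ → C3) : Tensor3 := fun k i j z =>
  ∑ s, (complGram ρ z)⁻¹ k s * (inner ℂ (complVec ρ s z) (pd i (tangentVec ρ j) z)).re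

/-- The averaged normal vector (mean curvature vector in the sphere)
`H n = ∑ g^{ij} Tᵏᵢⱼ Fₖ`. -/
def meanCurvatureVec (ρ : ℂ → C3) (z : ℂ) : C3 :=
  ∑ i, ∑ j, ∑ k, ((inducedMetric ρ z)⁻¹ i j * shapeTensor ρ k i j z) • complVec ρ k z

/-- The function `G = eᵘ (A + i B)`, `A = T¹₁₁`, `B = T²₂₂`. -/
def cubicG (ρ : ℂ → C3) (u : ℂ → ℝ) (z : ℂ) : ℂ :=
  (Real.exp (u z) : ℂ) * ((shapeTensor ρ 0 0 0 z : ℂ) + Complex.I * (shapeTensor ρ 1 1 1 z : ℂ))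

/-! Surfaces. A real surface is a smooth manifold `T` modelled on `ℂ = ℝ²`. -/

section Surface

variable {T : Type*} [TopologicalSpace T] [ChartedSpace ℂ T]

/-- `r` is a smooth immersion into the sphere `S_R ⊂ ℂ³` and at each point the unit normal vector
`N = r / R` of the sphere is orthogonal to the tangent plane in the Hermitian metric. -/
structure IsComplexlyNormalImmersion (R : ℝ) (r : T → C3) : Prop where
  smooth : ContMDiff 𝓘(ℝ, ℂ) 𝓘(ℝ, C3) ∞ r
  immersion : ∀ x, Function.Injective (mfderiv 𝓘(ℝ, ℂ) 𝓘(ℝ, C3) r x)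
  mem_sphere : ∀ x, ‖r x‖ = R
  normal : ∀ (x : T) (v : TangentSpace 𝓘(ℝ, ℂ) x),
    inner (E := C3) ℂ (mfderiv 𝓘(ℝ, ℂ) 𝓘(ℝ, C3) r x v) (R⁻¹ • r x) = 0

/-- `φ`, restricted to the open set `D`, is a regular local parametrization of `T`; its local
inverses are local coordinates `z = x¹ + i x²` on `T`. -/
structure IsLocalParam (φ : ℂ → T) (D : Set ℂ) : Prop where
  isOpen : IsOpen D
  localDiffeo : IsLocalDiffeomorphOn 𝓘(ℝ, ℂ) 𝓘(ℝ, ℂ) ∞ φ D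

/-- The mean curvature of the immersed surface in the sphere vanishes
(in all local coordinates). -/
def HasZeroMeanCurvature (r : T → C3) : Prop :=
  ∀ (φ : ℂ → T) (D : Set ℂ), IsLocalParam φ D → ∀ z ∈ D, meanCurvatureVec (r ∘ φ) z = 0

/-- `φ` on `D` gives isothermal coordinates: the induced metric is `2 R² eᵘ dz dz̄`. -/
structure IsIsothermal (R : ℝ) (r : T → C3) (φ : ℂ → T) (D : Set ℂ) (u : ℂ → ℝ) : Prop where
  param : IsLocalParam φ D
  metric : ∀ z ∈ D, inducedMetric (r ∘ φ) z = confMetric R u z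

/-- `T` is a torus and `p : ℂ → T` is its universal covering by an isothermal uniformizing
parameter: `p` identifies `T` with `ℂ / (ℤ ω₁ + ℤ ω₂)`. -/
structure IsTorusParam (R : ℝ) (r : T → C3) (p : ℂ → T) (ω₁ ω₂ : ℂ) (u : ℂ → ℝ) : Prop where
  isothermal : IsIsothermal R r p Set.univ u
  surjective : Function.Surjective p
  independent : LinearIndependent ℝ ![ω₁, ω₂]
  fiber : ∀ z w : ℂ, p z = p w ↔ ∃ m n : ℤ, z - w = m * ω₁ + n * ω₂

end Surface

end

/-! ### Partial derivatives in the plane -/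

section PartialDerivatives

variable {F : Type*} [NormedAddCommGroup F] [NormedSpace ℝ F]

/-! Let E₁, E₂ be the tangent vectors of a chart ρ and L = 2R²eᵘ. Differentiating ⟨E_j|ρ⟩ = 0 gives
⟨∂ᵢE_j|ρ⟩ = -⟨E_j|Eᵢ⟩. The left side is symmetric in i, j, so the Hermitian Gram matrix is real: ω =
0, F_k = iE_k, and E₁, E₂, ρ is an orthogonal basis of ℂ³ over ℂ (`inner_tangentVec`, `eq_sum`).
Everything is then contained in the numbers ⟨E_k|∂ᵢE_j⟩ = L(Γᵏᵢⱼ + iTᵏᵢⱼ). Their real parts are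
found by Koszul's argument. Their imaginary parts are totally symmetric, and trace-free by
minimality, so only A and B remain.

The equality ∂ᵢ∂_jE_l = ∂_j∂ᵢE_l, paired with E_k and expanded in the orthogonal frame
(`integrability`, `inner_pd_pd`), splits into two parts. The imaginary part is the pair of
Cauchy–Riemann equations for G = eᵘ(A + iB), and the real part is the scalar equation Δu = 4(A² +
B²) - 4eᵘ. Independently, the tensor equations of Codazzi and Gauss for a conformal metric reduce to
the same scalar equations (`codazziRicciEq_confMetric_iff`, `gaussEq_confMetric_iff`).

If G = 0 then T = 0 and the frame equations have real coefficients. The antilinear conjugation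
fixing E₁, E₂, ρ is then constant (`pd_frameConj`), so its fixed space, the real span of r and the
tangent plane, is locally constant and, by connectedness, constant. The surface lies in this space
V. The cone map (t, w) ↦ tρ(w) is a submersion onto V at t = 1, which makes the image open in V ∩
S_R.

On a torus u and G are determined by derivatives of ρ, hence doubly periodic, and Liouville's
theorem makes G constant. Rescaling z by c multiplies G by c³. When |G| = 1, A² + B² = e^{-2u} turns
the scalar Gauss equation into the Tzitzeica equation. -/

theorem pd_congr {f g : ℂ → F} {D : Set ℂ} (hD : IsOpen D) (h : ∀ z ∈ D, f z = g z)
    (i : Fin 2) {z : ℂ} (hz : z ∈ D) : pd i f z = pd i g z := by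
  have : f =ᶠ[nhds z] g := Filter.eventuallyEq_of_mem (hD.mem_nhds hz) h
  rw [pd, pd, this.fderiv_eq]

theorem ContDiffOn.differentiableAt_of_isOpen {f : ℂ → F} {D : Set ℂ} (hf : ContDiffOn ℝ ∞ f D)
    (hD : IsOpen D) {z : ℂ} (hz : z ∈ D) : DifferentiableAt ℝ f z :=
  (hf.contDiffAt (hD.mem_nhds hz)).differentiableAt (by simp)

theorem ContDiffOn.pd {f : ℂ → F} {D : Set ℂ} (hf : ContDiffOn ℝ ∞ f D) (hD : IsOpen D)
    (i : Fin 2) : ContDiffOn ℝ ∞ (pd i f) D :=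
  (hf.fderiv_of_isOpen hD (m := ∞) (by simp)).clm_apply contDiffOn_const

theorem pd_comm {f : ℂ → F} {D : Set ℂ} (hf : ContDiffOn ℝ ∞ f D) (hD : IsOpen D)
    (i j : Fin 2) {z : ℂ} (hz : z ∈ D) : pd i (pd j f) z = pd j (pd i f) z := by
  have hs : IsSymmSndFDerivAt ℝ f z :=
    (hf.contDiffAt (hD.mem_nhds hz)).isSymmSndFDerivAt
      (by simpa using WithTop.coe_le_coe.2 (le_top : (2 : ℕ∞) ≤ ⊤))
  have hd : DifferentiableAt ℝ (fderiv ℝ f) z :=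
    ((hf.fderiv_of_isOpen hD (m := ∞) (by simp)).contDiffAt (hD.mem_nhds hz)).differentiableAt
      (by simp)
  have key : ∀ a b : Fin 2, pd a (pd b f) z = fderiv ℝ (fderiv ℝ f) z (coordDir a) (coordDir b) := by
    intro a b
    have : pd b f = fun w => fderiv ℝ f w (coordDir b) := rfl
    rw [this, _root_.pd, fderiv_clm_apply hd (by fun_prop)]
    simp
  rw [key, key, hs.eq]

theorem pd_const (c : F) (i : Fin 2) (z : ℂ) : pd i (fun _ => c) z = 0 := by
  simp [pd]

theorem pd_add {f g : ℂ → F} {z : ℂ} (hf : DifferentiableAt ℝ f z) (hg : DifferentiableAt ℝ g z)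
    (i : Fin 2) : pd i (fun w => f w + g w) z = pd i f z + pd i g z := by
  simp [pd, fderiv_fun_add hf hg]

theorem pd_neg (f : ℂ → F) (i : Fin 2) (z : ℂ) : pd i (fun w => -f w) z = -pd i f z := by
  simp [pd, fderiv_fun_neg]

theorem pd_sub {f g : ℂ → F} {z : ℂ} (hf : DifferentiableAt ℝ f z) (hg : DifferentiableAt ℝ g z)
    (i : Fin 2) : pd i (fun w => f w - g w) z = pd i f z - pd i g z := by
  simp [pd, fderiv_fun_sub hf hg]

theorem pd_smul {c : ℂ → ℝ} {f : ℂ → F} {z : ℂ} (hc : DifferentiableAt ℝ c z)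
    (hf : DifferentiableAt ℝ f z) (i : Fin 2) :
    pd i (fun w => c w • f w) z = c z • pd i f z + pd i c z • f z := by
  simp [pd, fderiv_fun_smul hc hf]

theorem pd_mul {f g : ℂ → ℝ} {z : ℂ} (hf : DifferentiableAt ℝ f z) (hg : DifferentiableAt ℝ g z)
    (i : Fin 2) : pd i (fun w => f w * g w) z = f z * pd i g z + pd i f z * g z := by
  simp [pd, fderiv_fun_mul hf hg]; ring

theorem pd_const_mul {f : ℂ → ℝ} {z : ℂ} (c : ℝ) (hf : DifferentiableAt ℝ f z)
    (i : Fin 2) : pd i (fun w => c * f w) z = c * pd i f z := by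
  rw [pd_mul (by fun_prop) hf, pd_const]; ring

theorem pd_exp {u : ℂ → ℝ} {z : ℂ} (hu : DifferentiableAt ℝ u z) (i : Fin 2) :
    pd i (fun w => Real.exp (u w)) z = Real.exp (u z) * pd i u z := by
  simp [pd, fderiv_exp hu]

theorem pd_clm_comp {G : Type*} [NormedAddCommGroup G] [NormedSpace ℝ G] (L : F →L[ℝ] G)
    {f : ℂ → F} {z : ℂ} (hf : DifferentiableAt ℝ f z) (i : Fin 2) :
    pd i (fun w => L (f w)) z = L (pd i f z) := by
  have := (L.hasFDerivAt.comp z hf.hasFDerivAt).fderiv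
  rw [pd, pd]
  change fderiv ℝ (L ∘ f) z _ = _
  rw [this]; rfl

theorem pd_re {f : ℂ → ℂ} {z : ℂ} (hf : DifferentiableAt ℝ f z) (i : Fin 2) :
    pd i (fun w => (f w).re) z = (pd i f z).re :=
  pd_clm_comp Complex.reCLM hf i

theorem pd_im {f : ℂ → ℂ} {z : ℂ} (hf : DifferentiableAt ℝ f z) (i : Fin 2) :
    pd i (fun w => (f w).im) z = (pd i f z).im :=
  pd_clm_comp Complex.imCLM hf i

theorem pd_ofReal {f : ℂ → ℝ} {z : ℂ} (hf : DifferentiableAt ℝ f z) (i : Fin 2) :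
    pd i (fun w => (f w : ℂ)) z = ((pd i f z : ℝ) : ℂ) :=
  pd_clm_comp Complex.ofRealCLM hf i

theorem pd_inner {f g : ℂ → C3} {z : ℂ} (hf : DifferentiableAt ℝ f z)
    (hg : DifferentiableAt ℝ g z) (i : Fin 2) :
    pd i (fun w => inner ℂ (f w) (g w)) z = inner ℂ (f z) (pd i g z) + inner ℂ (pd i f z) (g z) :=
  fderiv_inner_apply ℂ hf hg _

theorem pd_comp_real_mul (f : ℂ → F) (c : ℝ) (i : Fin 2) (z : ℂ) :
    pd i (fun w => f (c * w)) z = c • pd i f (c * z) := by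
  -- For c ≠ 0 the scaling is a linear equivalence, so the chain rule needs no differentiability of
  -- `f`; for c = 0 both sides vanish.
  rcases eq_or_ne c 0 with rfl | hc
  · simp [pd]
  let e : ℂ ≃L[ℝ] ℂ := ContinuousLinearEquiv.smulLeft (Units.mk0 c hc)
  have h : (fun w : ℂ => f (c * w)) = f ∘ e := by
    funext w
    simp [e, Units.smul_def]
  have he : e z = c * z := by simp [e, Units.smul_def]
  have he' : e (coordDir i) = c • coordDir i := by simp [e, Units.smul_def]
  rw [pd, h, e.comp_right_fderiv]
  simp only [ContinuousLinearMap.comp_apply, ContinuousLinearEquiv.coe_coe, he, he', map_smul]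
  rfl

theorem pd_comp_add_right (f : ℂ → F) (a : ℂ) (i : Fin 2) (z : ℂ) :
    pd i (fun w => f (w + a)) z = pd i f (z + a) := by
  rw [pd, fderiv_comp_add_right, pd]

theorem pd_ofReal_add_I_mul {α β : ℂ → ℝ} {z : ℂ} (hα : DifferentiableAt ℝ α z)
    (hβ : DifferentiableAt ℝ β z) (i : Fin 2) :
    pd i (fun w => (α w : ℂ) + Complex.I * (β w : ℂ)) z
      = ((pd i α z : ℝ) : ℂ) + Complex.I * ((pd i β z : ℝ) : ℂ) := by
  have hα' : DifferentiableAt ℝ (fun w => (α w : ℂ)) z := Complex.ofRealCLM.differentiableAt.comp z hα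
  have hβ' : DifferentiableAt ℝ (fun w => (β w : ℂ)) z := Complex.ofRealCLM.differentiableAt.comp z hβ
  have h1 := pd_add hα' (hβ'.const_mul Complex.I) i
  have h2 := pd_clm_comp ((ContinuousLinearMap.mul ℝ ℂ) Complex.I) hβ' i
  simp only [ContinuousLinearMap.mul_apply'] at h2
  rw [h2, pd_ofReal hα, pd_ofReal hβ] at h1
  exact h1

/-- The Cauchy–Riemann equations. -/
theorem differentiableAt_complex_iff_pd {α β : ℂ → ℝ} {z : ℂ} (hα : DifferentiableAt ℝ α z)
    (hβ : DifferentiableAt ℝ β z) :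
    DifferentiableAt ℂ (fun w => (α w : ℂ) + Complex.I * (β w : ℂ)) z ↔
      pd 0 α z = pd 1 β z ∧ pd 1 α z = -pd 0 β z := by
  have hα' : DifferentiableAt ℝ (fun w => (α w : ℂ)) z := Complex.ofRealCLM.differentiableAt.comp z hα
  have hβ' : DifferentiableAt ℝ (fun w => (β w : ℂ)) z := Complex.ofRealCLM.differentiableAt.comp z hβ
  have hd : DifferentiableAt ℝ (fun w => (α w : ℂ) + Complex.I * (β w : ℂ)) z := by fun_prop
  have k0 := pd_ofReal_add_I_mul hα hβ 0
  have k1 := pd_ofReal_add_I_mul hα hβ 1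
  simp only [pd.eq_def (F := ℂ), coordDir, Matrix.cons_val_zero, Matrix.cons_val_one] at k0 k1
  rw [differentiableAt_complex_iff_differentiableAt_real, and_iff_right hd, k0, k1]
  simp only [Complex.ext_iff, smul_eq_mul, Complex.add_re, Complex.add_im, Complex.mul_re,
    Complex.mul_im, Complex.I_re, Complex.I_im, Complex.ofReal_re, Complex.ofReal_im]
  constructor
  · rintro ⟨h1, h2⟩
    constructor <;> linarith
  · rintro ⟨h1, h2⟩
    constructor <;> linarith

end PartialDerivatives

/-! ### Tensor calculus for a conformally Euclidean metric -/

section Conformal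

variable {R : ℝ} {u A B : ℂ → ℝ} {D : Set ℂ}

theorem confMetric_apply (R : ℝ) (u : ℂ → ℝ) (z : ℂ) (i j : Fin 2) :
    confMetric R u z i j = if i = j then 2 * R ^ 2 * Real.exp (u z) else 0 := by
  simp [confMetric, Matrix.one_apply]

theorem confFactor_pos (hR : R ≠ 0) (u : ℂ → ℝ) (z : ℂ) : 0 < 2 * R ^ 2 * Real.exp (u z) := by
  positivity

theorem inv_confMetric_apply (hR : R ≠ 0) (u : ℂ → ℝ) (z : ℂ) (i j : Fin 2) :
    (confMetric R u z)⁻¹ i j = if i = j then (2 * R ^ 2 * Real.exp (u z))⁻¹ else 0 := by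
  have h : (confMetric R u z)⁻¹ = (2 * R ^ 2 * Real.exp (u z))⁻¹ • (1 : Matrix (Fin 2) (Fin 2) ℝ) := by
    apply Matrix.inv_eq_right_inv
    rw [confMetric, smul_mul_smul_comm, mul_inv_cancel₀ (confFactor_pos hR u z).ne', mul_one, one_smul]
  simp [h, Matrix.one_apply]

theorem pd_confMetric {z : ℂ} (hu : DifferentiableAt ℝ u z) (i a b : Fin 2) :
    pd i (fun w => confMetric R u w a b) z =
      if a = b then 2 * R ^ 2 * Real.exp (u z) * pd i u z else 0 := by
  simp only [confMetric_apply]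
  split_ifs
  · rw [pd_const_mul _ (by fun_prop), pd_exp hu]; ring
  · exact pd_const 0 i z

theorem christoffel_confMetric (hR : R ≠ 0) {z : ℂ} (hu : DifferentiableAt ℝ u z) (k i j : Fin 2) :
    christoffel (confMetric R u) k i j z =
      ((if k = j then pd i u z else 0) + (if k = i then pd j u z else 0)
        - (if i = j then pd k u z else 0)) / 2 := by
  have := (confFactor_pos hR u z).ne'
  simp only [christoffel, pd_confMetric hu, inv_confMetric_apply hR]
  fin_cases k <;> fin_cases i <;> fin_cases j <;> simp [Fin.sum_univ_two] <;> field_simp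

theorem pd_christoffel_confMetric (hR : R ≠ 0) (hD : IsOpen D) (hu : ContDiffOn ℝ ∞ u D)
    {z : ℂ} (hz : z ∈ D) (l k i j : Fin 2) :
    pd l (christoffel (confMetric R u) k i j) z =
      ((if k = j then pd l (pd i u) z else 0) + (if k = i then pd l (pd j u) z else 0)
        - (if i = j then pd l (pd k u) z else 0)) / 2 := by
  have hd : ∀ a, DifferentiableAt ℝ (pd a u) z := fun a =>
    (hu.pd hD a).differentiableAt_of_isOpen hD hz
  have hd' : ∀ a, ∀ (P : Prop) [Decidable P],
      DifferentiableAt ℝ (fun w => (1 / 2 : ℝ) * (if P then pd a u w else 0)) z ∧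
      pd l (fun w => (1 / 2 : ℝ) * (if P then pd a u w else 0)) z
        = (1 / 2) * (if P then pd l (pd a u) z else 0) := by
    intro a P _
    split_ifs
    · exact ⟨(hd a).const_mul _, pd_const_mul _ (hd a) l⟩
    · simp [pd_const]
  rw [pd_congr hD (g := fun w => ((1 / 2 : ℝ) * (if k = j then pd i u w else 0)
      + (1 / 2) * (if k = i then pd j u w else 0)) - (1 / 2) * (if i = j then pd k u w else 0))
    (fun w hw => by
      rw [christoffel_confMetric hR (hu.differentiableAt_of_isOpen hD hw)]; ring) l hz,
    pd_sub ((hd' _ _).1.fun_add (hd' _ _).1) (hd' _ _).1, pd_add (hd' _ _).1 (hd' _ _).1,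
    (hd' _ _).2, (hd' _ _).2, (hd' _ _).2]
  ring

/-- In two dimensions the terms quadratic in the first derivatives of u cancel or vanish, leaving
only the Laplacian of u. -/
theorem riemann_confMetric (hR : R ≠ 0) (hD : IsOpen D) (hu : ContDiffOn ℝ ∞ u D)
    {z : ℂ} (hz : z ∈ D) (s k i j : Fin 2) :
    riemann (confMetric R u) s k i j z =
      -(pd 0 (pd 0 u) z + pd 1 (pd 1 u) z) / 2 *
        ((if s = i ∧ k = j then 1 else 0) - (if s = j ∧ k = i then 1 else 0)) := by
  have hs : pd 1 (pd 0 u) z = pd 0 (pd 1 u) z := pd_comm hu hD 1 0 hz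
  simp only [riemann, pd_christoffel_confMetric hR hD hu hz,
    christoffel_confMetric hR (hu.differentiableAt_of_isOpen hD hz), Fin.sum_univ_two]
  fin_cases s <;> fin_cases k <;> fin_cases i <;> fin_cases j <;> simp [hs] <;> ring

/-- For a metric `2 R² eᵘ dz dz̄` and a symmetric trace-free tensor the Gauss equation reduces to
one scalar equation. -/
theorem gaussEq_confMetric_iff (hR : R ≠ 0) (hD : IsOpen D) (hu : ContDiffOn ℝ ∞ u D) :
    GaussEq R (confMetric R u) (traceFreeTensor A B) D ↔
      ∀ z ∈ D, pd 0 (pd 0 u) z + pd 1 (pd 1 u) z =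
        4 * (A z ^ 2 + B z ^ 2) - 4 * Real.exp (u z) := by
  refine forall₂_congr fun z hz => ?_
  simp only [riemann_confMetric hR hD hu hz, confMetric_apply, traceFreeTensor, Fin.sum_univ_two]
  constructor
  · intro h
    -- Every nontrivial component of the curvature equals this one up to sign.
    have h1 := h 0 1 0 1
    simp at h1
    field_simp at h1
    linarith
  · intro h s k i j
    rw [h]
    fin_cases s <;> fin_cases k <;> fin_cases i <;> fin_cases j <;> simp <;> field_simp <;> ring

theorem lowerIndex_confMetric (R : ℝ) (u : ℂ → ℝ) (t : Tensor3) (k i j : Fin 2) (z : ℂ) :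
    lowerIndex (confMetric R u) t k i j z = 2 * R ^ 2 * Real.exp (u z) * t k i j z := by
  simp only [lowerIndex, confMetric_apply, mul_ite, mul_zero, Finset.sum_ite_eq',
    Finset.mem_univ, if_true]
  ring

/-- Lowering the index multiplies the components by 2R²eᵘ, so up to a constant they are ± the real
and imaginary parts of G. -/
theorem pd_lowerIndex_traceFreeTensor {z : ℂ} (hu : DifferentiableAt ℝ u z)
    (hA : DifferentiableAt ℝ A z) (hB : DifferentiableAt ℝ B z) (l k i j : Fin 2) :
    pd l (lowerIndex (confMetric R u) (traceFreeTensor A B) k i j) z =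
      2 * R ^ 2 * traceFreeTensor (pd l fun w => Real.exp (u w) * A w)
        (pd l fun w => Real.exp (u w) * B w) k i j z := by
  have h : ∀ f : ℂ → ℝ, DifferentiableAt ℝ f z →
      pd l (fun w => 2 * R ^ 2 * Real.exp (u w) * f w) z
        = 2 * R ^ 2 * pd l (fun w => Real.exp (u w) * f w) z := by
    intro f hf
    rw [← pd_const_mul _ (by fun_prop)]
    simp only [mul_assoc]
  have h' : ∀ f : ℂ → ℝ, DifferentiableAt ℝ f z →
      pd l (fun w => -(2 * R ^ 2 * Real.exp (u w) * f w)) z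
        = -(2 * R ^ 2 * pd l (fun w => Real.exp (u w) * f w) z) := by
    intro f hf
    rw [pd_neg, h f hf]
  have e : lowerIndex (confMetric R u) (traceFreeTensor A B) k i j =
      fun w => 2 * R ^ 2 * Real.exp (u w) * traceFreeTensor A B k i j w :=
    funext fun w => lowerIndex_confMetric ..
  rw [e]
  fin_cases k <;> fin_cases i <;> fin_cases j <;>
    simp [traceFreeTensor, h _ hA, h _ hB, h' _ hA, h' _ hB]

/-- For a metric `2 R² eᵘ dz dz̄` and a symmetric trace-free tensor the Peterson–Codazzi–Ricci
equations are the Cauchy–Riemann equations. -/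
theorem codazziRicciEq_confMetric_iff (hR : R ≠ 0)
    (hu : ∀ z ∈ D, DifferentiableAt ℝ u z) (hA : ∀ z ∈ D, DifferentiableAt ℝ A z)
    (hB : ∀ z ∈ D, DifferentiableAt ℝ B z) :
    CodazziRicciEq (confMetric R u) (traceFreeTensor A B) D ↔
      ∀ z ∈ D,
        pd 0 (fun w => Real.exp (u w) * A w) z = pd 1 (fun w => Real.exp (u w) * B w) z ∧
        pd 1 (fun w => Real.exp (u w) * A w) z = -pd 0 (fun w => Real.exp (u w) * B w) z := by
  refine forall₂_congr fun z hz => ?_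
  simp only [covDeriv, pd_lowerIndex_traceFreeTensor (hu z hz) (hA z hz) (hB z hz),
    christoffel_confMetric hR (hu z hz), lowerIndex_confMetric, Fin.sum_univ_two]
  have hR2 : (2 * R ^ 2) ≠ 0 := by positivity
  constructor
  · intro h
    -- These two components carry one Cauchy–Riemann equation each. The Christoffel terms cancel
    -- because the tensor is symmetric and trace-free and the metric is conformal.
    have h0 := h 0 1 0 0
    have h1 := h 0 1 0 1
    simp [traceFreeTensor] at h0 h1
    constructor
    · apply mul_left_cancel₀ hR2
      linarith
    · apply mul_left_cancel₀ hR2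
      linarith
  · rintro ⟨h0, h1⟩ i j s k
    fin_cases i <;> fin_cases j <;> fin_cases s <;> fin_cases k <;>
      simp [traceFreeTensor, h0, h1] <;> ring

end Conformal

/-! ### Minimal complexly normal surfaces in isothermal coordinates -/

section Frame

/-- `v` is recovered from its Hermitian products with three nonzero orthogonal vectors of `ℂ³`. -/
theorem C3.sum_orthogonal {e : Fin 3 → C3} {c : Fin 3 → ℝ} (hc : ∀ i, 0 < c i)
    (he : ∀ i j, inner ℂ (e i) (e j) = if i = j then (c i : ℂ) else 0) (v : C3) :
    v = ∑ i, ((c i : ℂ)⁻¹ * inner ℂ (e i) v) • e i := by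
  have hs : ∀ i, ((Real.sqrt (c i) : ℝ) : ℂ) * ((Real.sqrt (c i) : ℝ) : ℂ) = (c i : ℂ) := by
    intro i
    rw [← Complex.ofReal_mul, Real.mul_self_sqrt (hc i).le]
  have hs0 : ∀ i, ((Real.sqrt (c i) : ℝ) : ℂ) ≠ 0 := fun i => by
    exact_mod_cast (Real.sqrt_pos.2 (hc i)).ne'
  have ho : Orthonormal ℂ fun i => ((Real.sqrt (c i) : ℝ) : ℂ)⁻¹ • e i := by
    rw [orthonormal_iff_ite]
    intro i j
    rw [inner_smul_left, inner_smul_right, he]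
    split_ifs with h
    · subst h
      rw [← hs i]
      have := hs0 i
      simp only [map_inv₀, Complex.conj_ofReal]
      field_simp
    · simp
  let b := basisOfOrthonormalOfCardEqFinrank ho (by simp)
  have hb : ⇑b = fun i => ((Real.sqrt (c i) : ℝ) : ℂ)⁻¹ • e i :=
    coe_basisOfOrthonormalOfCardEqFinrank ho (by simp)
  let b' := b.toOrthonormalBasis (by rw [hb]; exact ho)
  have hb' : ⇑b' = fun i => ((Real.sqrt (c i) : ℝ) : ℂ)⁻¹ • e i := by
    rw [← hb]; simp [b']
  conv_lhs => rw [← b'.sum_repr' v, hb']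
  refine Finset.sum_congr rfl fun i _ => ?_
  rw [inner_smul_left, smul_smul]
  congr 1
  have := hs0 i
  rw [← hs i]
  simp only [map_inv₀, Complex.conj_ofReal]
  field_simp

theorem christoffel_congr {g g' : MetricField} {D : Set ℂ} (hD : IsOpen D)
    (h : ∀ z ∈ D, g z = g' z) {z : ℂ} (hz : z ∈ D) (k i j : Fin 2) :
    christoffel g k i j z = christoffel g' k i j z := by
  have hp : ∀ a b c, pd a (fun w => g w b c) z = pd a (fun w => g' w b c) z := fun a b c =>
    pd_congr hD (fun w hw => by rw [h w hw]) a hz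
  simp only [christoffel, hp, h z hz]

/-- Agreement on an open set passes to derivatives. This carries the equation from the conformal
model to the induced metric and the shape tensor, which are known only on `D`. -/
theorem GaussEq.congr {R : ℝ} {g g' : MetricField} {t t' : Tensor3} {D : Set ℂ} (hD : IsOpen D)
    (h : ∀ z ∈ D, g z = g' z) (ht : ∀ z ∈ D, ∀ k i j, t k i j z = t' k i j z)
    (H : GaussEq R g t D) : GaussEq R g' t' D := by
  intro z hz s k i j
  have hp : ∀ l a b c, pd l (christoffel g a b c) z = pd l (christoffel g' a b c) z :=
    fun l a b c => pd_congr hD (fun w hw => christoffel_congr hD h hw a b c) l hz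
  have := H z hz s k i j
  simpa only [riemann, hp, christoffel_congr hD h hz, h z hz, ht z hz] using this

theorem CodazziRicciEq.congr {g g' : MetricField} {t t' : Tensor3} {D : Set ℂ} (hD : IsOpen D)
    (h : ∀ z ∈ D, g z = g' z) (ht : ∀ z ∈ D, ∀ k i j, t k i j z = t' k i j z)
    (H : CodazziRicciEq g t D) : CodazziRicciEq g' t' D := by
  intro z hz i j s k
  have hl : ∀ w ∈ D, ∀ a b c, lowerIndex g t a b c w = lowerIndex g' t' a b c w := by
    intro w hw a b c
    simp only [lowerIndex, h w hw, ht w hw]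
  have hp : ∀ l a b c, pd l (lowerIndex g t a b c) z = pd l (lowerIndex g' t' a b c) z :=
    fun l a b c => pd_congr hD (fun w hw => hl w hw a b c) l hz
  have := H z hz i j s k
  simpa only [covDeriv, hp, christoffel_congr hD h hz, hl z hz] using this

theorem pd_tangentVec_comm {ρ : ℂ → C3} {D : Set ℂ} (hρ : ContDiffOn ℝ ∞ ρ D) (hD : IsOpen D)
    {z : ℂ} (hz : z ∈ D) (i j : Fin 2) : pd i (tangentVec ρ j) z = pd j (tangentVec ρ i) z :=
  pd_comm hρ hD i j hz

/-- A parametrized surface in the sphere of radius `R`, complexly normal, with zero mean curvature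
and with induced metric `2 R² eᵘ dz dz̄`. -/
structure IsMinimalChart (R : ℝ) (u : ℂ → ℝ) (ρ : ℂ → C3) (D : Set ℂ) : Prop where
  pos : 0 < R
  isOpen : IsOpen D
  smooth : ContDiffOn ℝ ∞ ρ D
  norm_eq : ∀ z ∈ D, ‖ρ z‖ = R
  normal : ∀ z ∈ D, ∀ i, inner ℂ (tangentVec ρ i z) (ρ z) = 0
  metric : ∀ z ∈ D, inducedMetric ρ z = confMetric R u z
  minimal : ∀ z ∈ D, meanCurvatureVec ρ z = 0

namespace IsMinimalChart

variable {R : ℝ} {u : ℂ → ℝ} {ρ : ℂ → C3} {D : Set ℂ} {z : ℂ}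

theorem contDiffOn_tangentVec (h : IsMinimalChart R u ρ D) (i : Fin 2) :
    ContDiffOn ℝ ∞ (tangentVec ρ i) D :=
  h.smooth.pd h.isOpen i

theorem differentiableAt (h : IsMinimalChart R u ρ D) (hz : z ∈ D) : DifferentiableAt ℝ ρ z :=
  h.smooth.differentiableAt_of_isOpen h.isOpen hz

theorem differentiableAt_tangentVec (h : IsMinimalChart R u ρ D) (hz : z ∈ D) (i : Fin 2) :
    DifferentiableAt ℝ (tangentVec ρ i) z :=
  (h.contDiffOn_tangentVec i).differentiableAt_of_isOpen h.isOpen hz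

theorem differentiableAt_pd_tangentVec (h : IsMinimalChart R u ρ D) (hz : z ∈ D) (i j : Fin 2) :
    DifferentiableAt ℝ (pd i (tangentVec ρ j)) z :=
  ((h.contDiffOn_tangentVec j).pd h.isOpen i).differentiableAt_of_isOpen h.isOpen hz

theorem confFactor_pos (h : IsMinimalChart R u ρ D) (z : ℂ) : 0 < 2 * R ^ 2 * Real.exp (u z) :=
  _root_.confFactor_pos h.pos.ne' u z

theorem inner_pd_tangentVec_self (h : IsMinimalChart R u ρ D) (hz : z ∈ D) (i j : Fin 2) :
    inner ℂ (pd i (tangentVec ρ j) z) (ρ z) = -inner ℂ (tangentVec ρ j z) (tangentVec ρ i z) := by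
  have h1 := pd_inner (h.differentiableAt_tangentVec hz j) (h.differentiableAt hz) i
  rw [pd_congr h.isOpen (g := fun _ => (0 : ℂ)) (fun w hw => h.normal w hw j) i hz, pd_const] at h1
  exact (neg_eq_of_add_eq_zero_right h1.symm).symm

/-- By `inner_pd_tangentVec_self` the Gram matrix is, up to sign, ⟨∂ᵢE_j|ρ⟩, which is symmetric
since partial derivatives commute. A matrix both Hermitian and symmetric is real, so ω = 0. -/
theorem inner_tangentVec (h : IsMinimalChart R u ρ D) (hz : z ∈ D) (i j : Fin 2) :
    inner ℂ (tangentVec ρ i z) (tangentVec ρ j z) =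
      if i = j then ((2 * R ^ 2 * Real.exp (u z) : ℝ) : ℂ) else 0 := by
  have hs : inner ℂ (tangentVec ρ i z) (tangentVec ρ j z)
      = inner ℂ (tangentVec ρ j z) (tangentVec ρ i z) := by
    apply neg_injective
    rw [← h.inner_pd_tangentVec_self hz, ← h.inner_pd_tangentVec_self hz,
      pd_tangentVec_comm h.smooth h.isOpen hz]
  have him : (inner ℂ (tangentVec ρ i z) (tangentVec ρ j z)).im = 0 := by
    have h1 := congrArg Complex.im hs
    rw [← inner_conj_symm (tangentVec ρ j z), Complex.conj_im] at h1
    linarith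
  have hre : (inner ℂ (tangentVec ρ i z) (tangentVec ρ j z)).re
      = if i = j then 2 * R ^ 2 * Real.exp (u z) else 0 := by
    rw [← confMetric_apply, ← h.metric z hz]; rfl
  apply Complex.ext
  · rw [hre]
    split_ifs
    · exact (Complex.ofReal_re _).symm
    · simp
  · rw [him]
    split_ifs
    · exact (Complex.ofReal_im _).symm
    · simp

theorem complVec_eq (h : IsMinimalChart R u ρ D) (hz : z ∈ D) (k : Fin 2) :
    complVec ρ k z = Complex.I • tangentVec ρ k z := by
  have : inducedOmega ρ z = 0 := by
    ext i j
    simp only [inducedOmega, Matrix.of_apply, h.inner_tangentVec hz, Matrix.zero_apply]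
    split_ifs
    · exact Complex.ofReal_im _
    · simp
  simp [complVec, this]

/-- Multiplication by i is an isometry, so the Gram matrix of the F_k = iE_k is again the metric,
and Re⟨iE_k|v⟩ = Im⟨E_k|v⟩. -/
theorem shapeTensor_eq (h : IsMinimalChart R u ρ D) (hz : z ∈ D) (k i j : Fin 2) :
    shapeTensor ρ k i j z = (2 * R ^ 2 * Real.exp (u z))⁻¹ *
      (inner ℂ (tangentVec ρ k z) (pd i (tangentVec ρ j) z)).im := by
  have hg : complGram ρ z = confMetric R u z := by
    rw [← h.metric z hz]
    ext a b
    simp [complGram, inducedMetric, h.complVec_eq hz, ← mul_assoc]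
  simp [shapeTensor, hg, inv_confMetric_apply h.pos.ne', h.complVec_eq hz]

theorem inner_tangentVec_pd_im (h : IsMinimalChart R u ρ D) (hz : z ∈ D) (k i j : Fin 2) :
    (inner ℂ (tangentVec ρ k z) (pd i (tangentVec ρ j) z)).im =
      2 * R ^ 2 * Real.exp (u z) * shapeTensor ρ k i j z := by
  rw [h.shapeTensor_eq hz, mul_inv_cancel_left₀ (h.confFactor_pos z).ne']

theorem differentiableAt_inner (h : IsMinimalChart R u ρ D) (hz : z ∈ D) (k i j : Fin 2) :
    DifferentiableAt ℝ (fun w => inner ℂ (tangentVec ρ k w) (pd i (tangentVec ρ j) w)) z :=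
  (h.differentiableAt_tangentVec hz k).inner ℂ (h.differentiableAt_pd_tangentVec hz i j)

/-- No regularity of u is assumed: u is the logarithm of |E₁|²/(2R²), and this is smooth. -/
theorem contDiffOn_conformal (h : IsMinimalChart R u ρ D) : ContDiffOn ℝ ∞ u D := by
  have h1 : ContDiffOn ℝ ∞ (fun w => inner ℂ (tangentVec ρ 0 w) (tangentVec ρ 0 w)) D :=
    (h.contDiffOn_tangentVec 0).inner ℂ (h.contDiffOn_tangentVec 0)
  have h2 : ContDiffOn ℝ ∞ (fun w => (inner ℂ (tangentVec ρ 0 w) (tangentVec ρ 0 w)).re) D :=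
    Complex.reCLM.contDiff.comp_contDiffOn h1
  have h3 : ∀ w ∈ D, (inner ℂ (tangentVec ρ 0 w) (tangentVec ρ 0 w)).re
      = 2 * R ^ 2 * Real.exp (u w) := by
    intro w hw
    rw [h.inner_tangentVec hw, if_pos rfl, Complex.ofReal_re]
  have hR := h.pos
  have h4 : ContDiffOn ℝ ∞ (fun w => Real.log
      ((2 * R ^ 2)⁻¹ * (inner ℂ (tangentVec ρ 0 w) (tangentVec ρ 0 w)).re)) D := by
    refine (contDiffOn_const.mul h2).log fun w hw => ?_
    rw [h3 w hw]
    positivity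
  refine h4.congr fun w hw => ?_
  rw [h3 w hw, inv_mul_cancel_left₀ (by positivity), Real.log_exp]

theorem differentiableAt_conformal (h : IsMinimalChart R u ρ D) (hz : z ∈ D) :
    DifferentiableAt ℝ u z :=
  h.contDiffOn_conformal.differentiableAt_of_isOpen h.isOpen hz

theorem differentiableAt_shapeTensor (h : IsMinimalChart R u ρ D) (hz : z ∈ D) (k i j : Fin 2) :
    DifferentiableAt ℝ (shapeTensor ρ k i j) z := by
  have hu := h.differentiableAt_conformal hz
  have h1 : DifferentiableAt ℝ (fun w =>
      (inner ℂ (tangentVec ρ k w) (pd i (tangentVec ρ j) w)).im) z :=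
    Complex.imCLM.differentiableAt.comp z (h.differentiableAt_inner hz k i j)
  have h2 : DifferentiableAt ℝ (fun w => (2 * R ^ 2 * Real.exp (u w))⁻¹ *
      (inner ℂ (tangentVec ρ k w) (pd i (tangentVec ρ j) w)).im) z :=
    DifferentiableAt.mul (DifferentiableAt.inv (by fun_prop) (h.confFactor_pos z).ne') h1
  exact h2.congr_of_eventuallyEq
    (Filter.eventuallyEq_of_mem (h.isOpen.mem_nhds hz) fun w hw => h.shapeTensor_eq hw k i j)

/-- This is the derivative of the known Gram matrix. Its imaginary part gives the symmetry of T in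
the outer indices, its real part the compatibility of Γ with the metric. -/
theorem inner_add_conj_inner (h : IsMinimalChart R u ρ D) (hz : z ∈ D) (k i j : Fin 2) :
    inner ℂ (tangentVec ρ k z) (pd i (tangentVec ρ j) z) +
      (starRingEnd ℂ) (inner ℂ (tangentVec ρ j z) (pd i (tangentVec ρ k) z)) =
      if k = j then ((2 * R ^ 2 * Real.exp (u z) * pd i u z : ℝ) : ℂ) else 0 := by
  have hu := h.differentiableAt_conformal hz
  rw [inner_conj_symm, ← pd_inner (h.differentiableAt_tangentVec hz k)
    (h.differentiableAt_tangentVec hz j) i,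
    pd_congr h.isOpen (fun w hw => h.inner_tangentVec hw k j) i hz]
  split_ifs
  · rw [pd_ofReal (by fun_prop), pd_const_mul _ (by fun_prop), pd_exp hu, mul_assoc (2 * R ^ 2)]
  · exact pd_const 0 i z

theorem shapeTensor_symm (h : IsMinimalChart R u ρ D) (hz : z ∈ D) (k i j : Fin 2) :
    shapeTensor ρ k i j z = shapeTensor ρ k j i z := by
  rw [h.shapeTensor_eq hz, h.shapeTensor_eq hz, pd_tangentVec_comm h.smooth h.isOpen hz]

/-- The Gram matrix is real, so the imaginary part of its derivative vanishes. Together with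
`shapeTensor_symm` this makes T totally symmetric. -/
theorem shapeTensor_symm' (h : IsMinimalChart R u ρ D) (hz : z ∈ D) (k i j : Fin 2) :
    shapeTensor ρ k i j z = shapeTensor ρ j i k z := by
  have h1 := congrArg Complex.im (h.inner_add_conj_inner hz k i j)
  rw [Complex.add_im, Complex.conj_im] at h1
  have h2 : (if k = j then ((2 * R ^ 2 * Real.exp (u z) * pd i u z : ℝ) : ℂ) else 0).im = 0 := by
    split_ifs
    · exact Complex.ofReal_im _
    · simp
  rw [h2] at h1
  rw [h.shapeTensor_eq hz, h.shapeTensor_eq hz, ← sub_eq_zero, ← mul_sub]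
  simp only [sub_eq_add_neg, h1, mul_zero]

theorem shapeTensor_trace (h : IsMinimalChart R u ρ D) (hz : z ∈ D) (k : Fin 2) :
    shapeTensor ρ k 0 0 z + shapeTensor ρ k 1 1 z = 0 := by
  have hl := (h.confFactor_pos z).ne'
  -- Since F_k = iE_k, pairing with E_k and taking the imaginary part isolates the k-th coefficient
  -- of the mean curvature vector.
  have h1 := congrArg (inner ℂ (tangentVec ρ k z)) (h.minimal z hz)
  simp only [meanCurvatureVec, h.metric z hz, inv_confMetric_apply h.pos.ne', Fin.sum_univ_two,
    h.complVec_eq hz, ← Complex.coe_smul, inner_add_right, inner_smul_right,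
    h.inner_tangentVec hz, inner_zero_right] at h1
  have h2 := congrArg Complex.im h1
  generalize 2 * R ^ 2 * Real.exp (u z) = L at h2 hl
  fin_cases k <;> simp at h2 ⊢ <;> field_simp at h2 <;> linarith

/-- A totally symmetric trace-free cubic form in two variables has two free components; these are
taken to be T¹₁₁ and T²₂₂. -/
theorem shapeTensor_eq_traceFreeTensor (h : IsMinimalChart R u ρ D) (hz : z ∈ D)
    (k i j : Fin 2) : shapeTensor ρ k i j z =
      traceFreeTensor (shapeTensor ρ 0 0 0) (shapeTensor ρ 1 1 1) k i j z := by
  have t0 := h.shapeTensor_trace hz 0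
  have t1 := h.shapeTensor_trace hz 1
  have s1 := h.shapeTensor_symm hz 0 1 0
  have s2 := h.shapeTensor_symm hz 1 1 0
  have s3 := h.shapeTensor_symm' hz 0 0 1
  have s4 := h.shapeTensor_symm' hz 0 1 1
  fin_cases k <;> fin_cases i <;> fin_cases j <;> simp [traceFreeTensor] <;> linarith

theorem inner_tangentVec_pd_re (h : IsMinimalChart R u ρ D) (hz : z ∈ D) (k i j : Fin 2) :
    (inner ℂ (tangentVec ρ k z) (pd i (tangentVec ρ j) z)).re =
      2 * R ^ 2 * Real.exp (u z) * christoffel (confMetric R u) k i j z := by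
  have key : ∀ k i j, (inner ℂ (tangentVec ρ k z) (pd i (tangentVec ρ j) z)).re
      + (inner ℂ (tangentVec ρ j z) (pd i (tangentVec ρ k) z)).re
      = if k = j then 2 * R ^ 2 * Real.exp (u z) * pd i u z else 0 := by
    intro k i j
    have h1 := congrArg Complex.re (h.inner_add_conj_inner hz k i j)
    rw [Complex.add_re, Complex.conj_re] at h1
    rw [h1]
    split_ifs
    · exact Complex.ofReal_re _
    · simp
  -- Koszul's argument: metric compatibility for three permutations of the indices, solved using the
  -- symmetry ∂ᵢE_j = ∂_jEᵢ.
  have h1 := key k i j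
  have h2 := key i j k
  have h3 := key j k i
  rw [pd_tangentVec_comm h.smooth h.isOpen hz j k] at h2
  rw [pd_tangentVec_comm h.smooth h.isOpen hz k i, pd_tangentVec_comm h.smooth h.isOpen hz j i] at *
  rw [christoffel_confMetric h.pos.ne' (h.differentiableAt_conformal hz)]
  fin_cases k <;> fin_cases i <;> fin_cases j <;> simp at h1 h2 h3 ⊢ <;> linarith

theorem inner_tangentVec_pd (h : IsMinimalChart R u ρ D) (hz : z ∈ D) (k i j : Fin 2) :
    inner ℂ (tangentVec ρ k z) (pd i (tangentVec ρ j) z) =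
      ((2 * R ^ 2 * Real.exp (u z) : ℝ) : ℂ) * (((christoffel (confMetric R u) k i j z : ℝ) : ℂ)
        + Complex.I * ((shapeTensor ρ k i j z : ℝ) : ℂ)) := by
  apply Complex.ext
  · rw [h.inner_tangentVec_pd_re hz]; simp only [Complex.re_ofReal_mul]; simp
  · rw [h.inner_tangentVec_pd_im hz]; simp only [Complex.im_ofReal_mul]; simp

theorem inner_self_pd_tangentVec (h : IsMinimalChart R u ρ D) (hz : z ∈ D) (i j : Fin 2) :
    inner ℂ (ρ z) (pd i (tangentVec ρ j) z) =
      if i = j then -((2 * R ^ 2 * Real.exp (u z) : ℝ) : ℂ) else 0 := by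
  rw [← inner_conj_symm, h.inner_pd_tangentVec_self hz, map_neg, inner_conj_symm,
    h.inner_tangentVec hz]
  split_ifs <;> simp

theorem inner_self (h : IsMinimalChart R u ρ D) (hz : z ∈ D) :
    inner ℂ (ρ z) (ρ z) = ((R ^ 2 : ℝ) : ℂ) := by
  rw [inner_self_eq_norm_sq_to_K, h.norm_eq z hz]; simp

/-- The vectors `E₁`, `E₂`, `ρ` form an orthogonal basis of `ℂ³`. -/
theorem eq_sum (h : IsMinimalChart R u ρ D) (hz : z ∈ D) (v : C3) :
    v = ∑ k, (((2 * R ^ 2 * Real.exp (u z) : ℝ) : ℂ)⁻¹ * inner ℂ (tangentVec ρ k z) v) •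
        tangentVec ρ k z + (((R ^ 2 : ℝ) : ℂ)⁻¹ * inner ℂ (ρ z) v) • ρ z := by
  have hl := h.confFactor_pos z
  have hR : 0 < R ^ 2 := pow_pos h.pos 2
  have hn : ∀ i, inner ℂ (ρ z) (tangentVec ρ i z) = 0 := fun i =>
    inner_eq_zero_symm.1 (h.normal z hz i)
  have := C3.sum_orthogonal (e := ![tangentVec ρ 0 z, tangentVec ρ 1 z, ρ z])
    (c := ![2 * R ^ 2 * Real.exp (u z), 2 * R ^ 2 * Real.exp (u z), R ^ 2])
    (fun i => by fin_cases i <;> simp only [Fin.zero_eta, Fin.mk_one, Fin.reduceFinMk] <;> assumption)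
    (fun i j => by
      fin_cases i <;> fin_cases j <;>
        simp [-inner_self_eq_norm_sq_to_K, h.inner_tangentVec hz, hn, h.normal z hz, h.inner_self hz]) v
  rw [Fin.sum_univ_three] at this
  rw [Fin.sum_univ_two]
  exact this

/-- Parseval's identity for the orthogonal frame E₁, E₂, ρ. -/
theorem inner_eq_sum (h : IsMinimalChart R u ρ D) (hz : z ∈ D) (v w : C3) :
    inner ℂ v w = ∑ k, ((2 * R ^ 2 * Real.exp (u z) : ℝ) : ℂ)⁻¹ *
        ((starRingEnd ℂ) (inner ℂ (tangentVec ρ k z) v) * inner ℂ (tangentVec ρ k z) w)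
        + ((R ^ 2 : ℝ) : ℂ)⁻¹ * ((starRingEnd ℂ) (inner ℂ (ρ z) v) * inner ℂ (ρ z) w) := by
  conv_lhs => rw [h.eq_sum hz w]
  rw [inner_add_right, inner_sum, inner_smul_right]
  simp only [inner_smul_right, inner_conj_symm]
  congr 1
  · exact Finset.sum_congr rfl fun k _ => by ring
  · ring

theorem frame_eq (h : IsMinimalChart R u ρ D) (hz : z ∈ D) (i j : Fin 2) :
    pd i (tangentVec ρ j) z =
      (∑ k, christoffel (inducedMetric ρ) k i j z • tangentVec ρ k z)
        + (∑ k, shapeTensor ρ k i j z • complVec ρ k z)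
        - (R⁻¹ * inducedMetric ρ z i j) • (R⁻¹ • ρ z) := by
  have hl : ((2 * R ^ 2 * Real.exp (u z) : ℝ) : ℂ) ≠ 0 := by
    exact_mod_cast (h.confFactor_pos z).ne'
  conv_lhs => rw [h.eq_sum hz (pd i (tangentVec ρ j) z)]
  simp only [h.inner_tangentVec_pd hz, inv_mul_cancel_left₀ hl, h.inner_self_pd_tangentVec hz,
    christoffel_congr h.isOpen h.metric hz, h.complVec_eq hz, h.metric z hz, confMetric_apply, ← Complex.coe_smul,
    ← Finset.sum_add_distrib, sub_eq_add_neg, ← neg_smul, smul_smul, ← add_smul]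
  congr 1
  · exact Finset.sum_congr rfl fun k _ => by rw [mul_comm Complex.I]
  · congr 1
    split_ifs <;> simp
    ring

/-! ### Integrability conditions of the moving frame equations -/

/-- The third derivatives of ρ cancel, leaving products of second derivatives, which Parseval's
identity expresses through Γ and T. -/
theorem integrability (h : IsMinimalChart R u ρ D) (hz : z ∈ D) (k i j l : Fin 2) :
    pd i (fun w => inner ℂ (tangentVec ρ k w) (pd j (tangentVec ρ l) w)) z
      - pd j (fun w => inner ℂ (tangentVec ρ k w) (pd i (tangentVec ρ l) w)) z
      = inner ℂ (pd i (tangentVec ρ k) z) (pd j (tangentVec ρ l) z)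
        - inner ℂ (pd j (tangentVec ρ k) z) (pd i (tangentVec ρ l) z) := by
  rw [pd_inner (h.differentiableAt_tangentVec hz k) (h.differentiableAt_pd_tangentVec hz j l),
    pd_inner (h.differentiableAt_tangentVec hz k) (h.differentiableAt_pd_tangentVec hz i l),
    pd_comm (h.contDiffOn_tangentVec l) h.isOpen i j hz]
  ring

theorem integrability_re (h : IsMinimalChart R u ρ D) (hz : z ∈ D) (k i j l : Fin 2) :
    pd i (fun w => 2 * R ^ 2 * Real.exp (u w) * christoffel (confMetric R u) k j l w) z
      - pd j (fun w => 2 * R ^ 2 * Real.exp (u w) * christoffel (confMetric R u) k i l w) z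
      = (inner ℂ (pd i (tangentVec ρ k) z) (pd j (tangentVec ρ l) z)).re
        - (inner ℂ (pd j (tangentVec ρ k) z) (pd i (tangentVec ρ l) z)).re := by
  rw [← Complex.sub_re, ← h.integrability hz, Complex.sub_re,
    ← pd_re (h.differentiableAt_inner hz k j l), ← pd_re (h.differentiableAt_inner hz k i l),
    pd_congr h.isOpen (fun w hw => h.inner_tangentVec_pd_re hw k j l) i hz,
    pd_congr h.isOpen (fun w hw => h.inner_tangentVec_pd_re hw k i l) j hz]

theorem integrability_im (h : IsMinimalChart R u ρ D) (hz : z ∈ D) (k i j l : Fin 2) :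
    pd i (fun w => 2 * R ^ 2 * Real.exp (u w) * shapeTensor ρ k j l w) z
      - pd j (fun w => 2 * R ^ 2 * Real.exp (u w) * shapeTensor ρ k i l w) z
      = (inner ℂ (pd i (tangentVec ρ k) z) (pd j (tangentVec ρ l) z)).im
        - (inner ℂ (pd j (tangentVec ρ k) z) (pd i (tangentVec ρ l) z)).im := by
  rw [← Complex.sub_im, ← h.integrability hz, Complex.sub_im,
    ← pd_im (h.differentiableAt_inner hz k j l), ← pd_im (h.differentiableAt_inner hz k i l),
    pd_congr h.isOpen (fun w hw => h.inner_tangentVec_pd_im hw k j l) i hz,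
    pd_congr h.isOpen (fun w hw => h.inner_tangentVec_pd_im hw k i l) j hz]

theorem inner_pd_pd (h : IsMinimalChart R u ρ D) (hz : z ∈ D) (i k j l : Fin 2) :
    inner ℂ (pd i (tangentVec ρ k) z) (pd j (tangentVec ρ l) z) =
      ((2 * R ^ 2 * Real.exp (u z) * ∑ m,
          (christoffel (confMetric R u) m i k z * christoffel (confMetric R u) m j l z
            + shapeTensor ρ m i k z * shapeTensor ρ m j l z)
        + (if i = k then 2 * R ^ 2 * Real.exp (u z) else 0)
          * (if j = l then 2 * R ^ 2 * Real.exp (u z) else 0) / R ^ 2 : ℝ) : ℂ)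
      + Complex.I * ((2 * R ^ 2 * Real.exp (u z) * ∑ m,
          (christoffel (confMetric R u) m i k z * shapeTensor ρ m j l z
            - shapeTensor ρ m i k z * christoffel (confMetric R u) m j l z) : ℝ) : ℂ) := by
  have hR : (R : ℂ) ≠ 0 := Complex.ofReal_ne_zero.2 h.pos.ne'
  have hl := Complex.ofReal_ne_zero.2 (h.confFactor_pos z).ne'
  have hN : ∀ a b : Fin 2, (if a = b then -((2 * R ^ 2 * Real.exp (u z) : ℝ) : ℂ) else 0)
      = ((-(if a = b then 2 * R ^ 2 * Real.exp (u z) else 0) : ℝ) : ℂ) := by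
    intro a b
    split_ifs <;> simp
  rw [h.inner_eq_sum hz (pd i (tangentVec ρ k) z) (pd j (tangentVec ρ l) z)]
  simp only [h.inner_tangentVec_pd hz, h.inner_self_pd_tangentVec hz, Fin.sum_univ_two, hN]
  generalize (if i = k then 2 * R ^ 2 * Real.exp (u z) else 0) = a
  generalize (if j = l then 2 * R ^ 2 * Real.exp (u z) else 0) = b
  generalize 2 * R ^ 2 * Real.exp (u z) = L at hl
  simp only [map_mul, map_add, map_neg, Complex.conj_ofReal, Complex.conj_I, Complex.ofReal_add,
    Complex.ofReal_mul, Complex.ofReal_sub, Complex.ofReal_div, Complex.ofReal_pow,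
    Complex.ofReal_neg]
  field_simp
  ring_nf
  simp only [Complex.I_sq]
  ring

theorem inner_pd_pd_re (h : IsMinimalChart R u ρ D) (hz : z ∈ D) (i k j l : Fin 2) :
    (inner ℂ (pd i (tangentVec ρ k) z) (pd j (tangentVec ρ l) z)).re =
      2 * R ^ 2 * Real.exp (u z) * ∑ m,
          (christoffel (confMetric R u) m i k z * christoffel (confMetric R u) m j l z
            + shapeTensor ρ m i k z * shapeTensor ρ m j l z)
        + (if i = k then 2 * R ^ 2 * Real.exp (u z) else 0)
          * (if j = l then 2 * R ^ 2 * Real.exp (u z) else 0) / R ^ 2 := by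
  rw [h.inner_pd_pd hz, Complex.add_re, Complex.ofReal_re, Complex.re_mul_ofReal, Complex.I_re,
    zero_mul, add_zero]

theorem inner_pd_pd_im (h : IsMinimalChart R u ρ D) (hz : z ∈ D) (i k j l : Fin 2) :
    (inner ℂ (pd i (tangentVec ρ k) z) (pd j (tangentVec ρ l) z)).im =
      2 * R ^ 2 * Real.exp (u z) * ∑ m,
          (christoffel (confMetric R u) m i k z * shapeTensor ρ m j l z
            - shapeTensor ρ m i k z * christoffel (confMetric R u) m j l z) := by
  rw [h.inner_pd_pd hz, Complex.add_im, Complex.ofReal_im, Complex.im_mul_ofReal, Complex.I_im,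
    one_mul, zero_add]

theorem pd_mul_shapeTensor (h : IsMinimalChart R u ρ D) (hz : z ∈ D) (l k i j : Fin 2) :
    pd l (fun w => 2 * R ^ 2 * Real.exp (u w) * shapeTensor ρ k i j w) z =
      2 * R ^ 2 * traceFreeTensor (pd l fun w => Real.exp (u w) * shapeTensor ρ 0 0 0 w)
        (pd l fun w => Real.exp (u w) * shapeTensor ρ 1 1 1 w) k i j z := by
  rw [← pd_lowerIndex_traceFreeTensor (h.differentiableAt_conformal hz)
    (h.differentiableAt_shapeTensor hz 0 0 0) (h.differentiableAt_shapeTensor hz 1 1 1)]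
  refine pd_congr h.isOpen (fun w hw => ?_) l hz
  rw [lowerIndex_confMetric, h.shapeTensor_eq_traceFreeTensor hw]

theorem cauchyRiemann (h : IsMinimalChart R u ρ D) (hz : z ∈ D) :
    pd 0 (fun w => Real.exp (u w) * shapeTensor ρ 0 0 0 w) z =
      pd 1 (fun w => Real.exp (u w) * shapeTensor ρ 1 1 1 w) z ∧
    pd 1 (fun w => Real.exp (u w) * shapeTensor ρ 0 0 0 w) z =
      -pd 0 (fun w => Real.exp (u w) * shapeTensor ρ 1 1 1 w) z := by
  have hR : R ≠ 0 := h.pos.ne'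
  have hl := (h.confFactor_pos z).ne'
  -- In the imaginary part of the integrability condition the mixed products ΓT cancel, again
  -- because T is symmetric and trace-free and the metric conformal.
  have key : ∀ k, traceFreeTensor (pd 1 fun w => Real.exp (u w) * shapeTensor ρ 0 0 0 w)
        (pd 1 fun w => Real.exp (u w) * shapeTensor ρ 1 1 1 w) k 0 0 z
      - traceFreeTensor (pd 0 fun w => Real.exp (u w) * shapeTensor ρ 0 0 0 w)
        (pd 0 fun w => Real.exp (u w) * shapeTensor ρ 1 1 1 w) k 1 0 z = 0 := by
    intro k
    have h1 := h.integrability_im hz k 1 0 0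
    rw [h.pd_mul_shapeTensor hz, h.pd_mul_shapeTensor hz, ← mul_sub] at h1
    refine (mul_eq_zero.1 (h1.trans ?_)).resolve_left (by positivity)
    rw [h.inner_pd_pd_im hz, h.inner_pd_pd_im hz]
    simp only [Fin.sum_univ_two, christoffel_confMetric hR (h.differentiableAt_conformal hz),
      h.shapeTensor_eq_traceFreeTensor hz]
    fin_cases k <;> simp [traceFreeTensor] <;> ring
  have k0 := key 0
  have k1 := key 1
  simp [traceFreeTensor] at k0 k1
  constructor <;> linarith

theorem gauss_scalar (h : IsMinimalChart R u ρ D) (hz : z ∈ D) :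
    pd 0 (pd 0 u) z + pd 1 (pd 1 u) z =
      4 * (shapeTensor ρ 0 0 0 z ^ 2 + shapeTensor ρ 1 1 1 z ^ 2) - 4 * Real.exp (u z) := by
  have hR : R ≠ 0 := h.pos.ne'
  have hl := (h.confFactor_pos z).ne'
  have hu := h.contDiffOn_conformal
  have hud := h.differentiableAt_conformal hz
  have hc : ∀ k i j, DifferentiableAt ℝ (christoffel (confMetric R u) k i j) z := by
    intro k i j
    have hd : ∀ (a : Fin 2) (P : Prop) [Decidable P],
        DifferentiableAt ℝ (fun w => if P then pd a u w else 0) z := by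
      intro a P _
      split_ifs
      · exact (hu.pd h.isOpen a).differentiableAt_of_isOpen h.isOpen hz
      · fun_prop
    have hs : DifferentiableAt ℝ (fun w => ((if k = j then pd i u w else 0)
        + (if k = i then pd j u w else 0) - (if i = j then pd k u w else 0)) / 2) z :=
      (((hd i (k = j)).fun_add (hd j (k = i))).fun_sub (hd k (i = j))).mul_const (2 : ℝ)⁻¹
    exact hs.congr_of_eventuallyEq
      (Filter.eventuallyEq_of_mem (h.isOpen.mem_nhds hz) fun w hw =>
        christoffel_confMetric hR (h.differentiableAt_conformal hw) k i j)
  -- The curvature component that does not vanish identically; the ρ-component in Parseval's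
  -- identity is the source of the term -4eᵘ.
  have h1 := h.integrability_re hz 1 1 0 0
  have hL : ∀ i, pd i (fun w => 2 * R ^ 2 * Real.exp (u w)) z
      = 2 * R ^ 2 * Real.exp (u z) * pd i u z := by
    intro i
    rw [pd_const_mul _ (by fun_prop), pd_exp hud]; ring
  rw [pd_mul (by fun_prop) (hc _ _ _), pd_mul (by fun_prop) (hc _ _ _), hL, hL,
    pd_christoffel_confMetric hR h.isOpen hu hz, pd_christoffel_confMetric hR h.isOpen hu hz,
    h.inner_pd_pd_re hz, h.inner_pd_pd_re hz] at h1
  simp only [Fin.sum_univ_two, christoffel_confMetric hR hud, h.shapeTensor_eq_traceFreeTensor hz] at h1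
  -- Expressing eᵘ through L = 2R²eᵘ leaves an identity rational in L.
  have hE : Real.exp (u z) = 2 * R ^ 2 * Real.exp (u z) / (2 * R ^ 2) := by field_simp
  rw [hE]
  generalize 2 * R ^ 2 * Real.exp (u z) = L at hl h1
  simp [traceFreeTensor] at h1
  field_simp at h1 ⊢
  linarith

theorem codazziRicciEq (h : IsMinimalChart R u ρ D) :
    CodazziRicciEq (inducedMetric ρ) (shapeTensor ρ) D := by
  refine CodazziRicciEq.congr h.isOpen (fun z hz => (h.metric z hz).symm)
    (fun z hz k i j => (h.shapeTensor_eq_traceFreeTensor hz k i j).symm)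
    ((codazziRicciEq_confMetric_iff h.pos.ne' (fun _ hz => h.differentiableAt_conformal hz)
      (fun _ hz => h.differentiableAt_shapeTensor hz _ _ _)
      (fun _ hz => h.differentiableAt_shapeTensor hz _ _ _)).2 fun _ hz => h.cauchyRiemann hz)

theorem gaussEq (h : IsMinimalChart R u ρ D) :
    GaussEq R (inducedMetric ρ) (shapeTensor ρ) D :=
  GaussEq.congr h.isOpen (fun z hz => (h.metric z hz).symm)
    (fun _ hz k i j => (h.shapeTensor_eq_traceFreeTensor hz k i j).symm)
    ((gaussEq_confMetric_iff h.pos.ne' h.isOpen h.contDiffOn_conformal).2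
      fun _ hz => h.gauss_scalar hz)

theorem differentiableOn_cubicG (h : IsMinimalChart R u ρ D) :
    DifferentiableOn ℂ (cubicG ρ u) D := by
  intro z hz
  have hu := h.differentiableAt_conformal hz
  have hA := h.differentiableAt_shapeTensor hz 0 0 0
  have hB := h.differentiableAt_shapeTensor hz 1 1 1
  have e : cubicG ρ u = fun w => ((Real.exp (u w) * shapeTensor ρ 0 0 0 w : ℝ) : ℂ)
      + Complex.I * ((Real.exp (u w) * shapeTensor ρ 1 1 1 w : ℝ) : ℂ) := by
    funext w
    rw [cubicG]
    push_cast
    ring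
  rw [e]
  exact ((differentiableAt_complex_iff_pd (by fun_prop) (by fun_prop)).2
    (h.cauchyRiemann hz)).differentiableWithinAt

end IsMinimalChart

end Frame

/-! ### The real subspace spanned by the position vector and the tangent plane -/

section RealSpan

theorem pd_complex_smul {c : ℂ → ℂ} {f : ℂ → C3} {z : ℂ} (hc : DifferentiableAt ℝ c z)
    (hf : DifferentiableAt ℝ f z) (i : Fin 2) :
    pd i (fun w => c w • f w) z = c z • pd i f z + pd i c z • f z := by
  simp [pd, fderiv_fun_smul hc hf]

theorem fderiv_apply_eq_pd {F : Type*} [NormedAddCommGroup F] [NormedSpace ℝ F] (f : ℂ → F)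
    (z h : ℂ) : fderiv ℝ f z h = h.re • pd 0 f z + h.im • pd 1 f z := by
  conv_lhs => rw [← Complex.re_add_im h]
  simp only [pd, coordDir, Matrix.cons_val_zero, Matrix.cons_val_one, ← map_smul, ← map_add]
  congr 1
  simp

theorem fderiv_eq_zero_of_pd {F : Type*} [NormedAddCommGroup F] [NormedSpace ℝ F] {f : ℂ → F}
    {z : ℂ} (h : ∀ i, pd i f z = 0) : fderiv ℝ f z = 0 := by
  ext v
  simp only [fderiv_apply_eq_pd, h, smul_zero, add_zero]
  rfl

/-- For an orthogonal frame `E₁`, `E₂`, `ρ` of `ℂ³`, the conjugation fixing the frame vectors. -/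
noncomputable def frameConj (R : ℝ) (u : ℂ → ℝ) (ρ : ℂ → C3) (z : ℂ) (v : C3) : C3 :=
  ∑ k, (((2 * R ^ 2 * Real.exp (u z) : ℝ) : ℂ)⁻¹ * inner ℂ v (tangentVec ρ k z)) • tangentVec ρ k z
    + (((R ^ 2 : ℝ) : ℂ)⁻¹ * inner ℂ v (ρ z)) • ρ z

namespace IsMinimalChart

variable {R : ℝ} {u : ℂ → ℝ} {ρ : ℂ → C3} {D : Set ℂ} {z : ℂ}

/-- The conjugation conjugates the coordinates with respect to E₁, E₂, ρ, so it fixes exactly the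
vectors with real coordinates. -/
theorem frameConj_eq_self_iff (h : IsMinimalChart R u ρ D) (hz : z ∈ D) (v : C3) :
    frameConj R u ρ z v = v ↔ ∃ (t : ℝ) (a : ℂ), v = t • ρ z + fderiv ℝ ρ z a := by
  have hl := Complex.ofReal_ne_zero.2 (h.confFactor_pos z).ne'
  have hR := Complex.ofReal_ne_zero.2 (pow_pos h.pos 2).ne'
  have hn : ∀ i, inner ℂ (ρ z) (tangentVec ρ i z) = 0 := fun i =>
    inner_eq_zero_symm.1 (h.normal z hz i)
  constructor
  · intro hv
    have h1 := h.eq_sum hz v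
    -- Averaging v with its conjugate replaces each coordinate by its real part.
    have h2 : v = (2⁻¹ : ℂ) • (v + frameConj R u ρ z v) := by
      rw [hv, ← two_smul ℂ, smul_smul]; simp
    refine ⟨(R ^ 2)⁻¹ * (inner ℂ (ρ z) v).re,
      ⟨(2 * R ^ 2 * Real.exp (u z))⁻¹ * (inner ℂ (tangentVec ρ 0 z) v).re,
        (2 * R ^ 2 * Real.exp (u z))⁻¹ * (inner ℂ (tangentVec ρ 1 z) v).re⟩, ?_⟩
    rw [fderiv_apply_eq_pd]
    conv_lhs => rw [h2]
    conv_lhs => enter [2, 1]; rw [h1]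
    have hc : ∀ w : C3, (((inner ℂ w v).re : ℝ) : ℂ) = 2⁻¹ * (inner ℂ w v + inner ℂ v w) := by
      intro w
      rw [← inner_conj_symm v w, Complex.re_eq_add_conj]; ring
    simp only [frameConj, Fin.sum_univ_two, ← Complex.coe_smul, Complex.ofReal_mul,
      Complex.ofReal_inv, hc]
    change _ = _ + (_ • tangentVec ρ 0 z + _ • tangentVec ρ 1 z)
    module
  · rintro ⟨t, a, rfl⟩
    rw [fderiv_apply_eq_pd]
    change frameConj R u ρ z (t • ρ z + (a.re • tangentVec ρ 0 z + a.im • tangentVec ρ 1 z)) =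
      t • ρ z + (a.re • tangentVec ρ 0 z + a.im • tangentVec ρ 1 z)
    simp only [frameConj, Fin.sum_univ_two, ← Complex.coe_smul, inner_add_left, inner_smul_left,
      h.inner_tangentVec hz, hn, h.normal z hz, h.inner_self hz, Complex.conj_ofReal]
    generalize ((2 * R ^ 2 * Real.exp (u z) : ℝ) : ℂ) = L at hl
    generalize ((R ^ 2 : ℝ) : ℂ) = Q at hR
    simp
    match_scalars <;> field_simp <;> rfl

theorem differentiableAt_frameConj (h : IsMinimalChart R u ρ D) (hz : z ∈ D) (v : C3) :
    DifferentiableAt ℝ (fun w => frameConj R u ρ w v) z := by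
  have hu := h.differentiableAt_conformal hz
  have hl := (h.confFactor_pos z).ne'
  have hE := h.differentiableAt_tangentVec hz
  have hρ := h.differentiableAt hz
  have hi : ∀ {f : ℂ → C3}, DifferentiableAt ℝ f z →
      DifferentiableAt ℝ (fun w => inner ℂ v (f w)) z :=
    fun hf => (differentiableAt_const v).inner ℂ hf
  have hL : DifferentiableAt ℝ (fun w => ((2 * R ^ 2 * Real.exp (u w) : ℝ) : ℂ)⁻¹) z := by
    have hd : DifferentiableAt ℝ (fun w => 2 * R ^ 2 * Real.exp (u w)) z := by fun_prop
    have : DifferentiableAt ℝ (fun w => ((2 * R ^ 2 * Real.exp (u w) : ℝ) : ℂ)) z :=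
      Complex.ofRealCLM.differentiableAt.comp z hd
    exact this.fun_inv (Complex.ofReal_ne_zero.2 hl)
  simp only [frameConj, Fin.sum_univ_two]
  exact ((((hL.mul (hi (hE 0))).smul (hE 0))).add ((hL.mul (hi (hE 1))).smul (hE 1))).add
    (((hi hρ).const_mul _).smul hρ)

/-- If the tensor `T` vanishes, then the conjugation fixing the moving frame is parallel. -/
theorem pd_frameConj (h : IsMinimalChart R u ρ D)
    (hT : ∀ w ∈ D, ∀ k i j, shapeTensor ρ k i j w = 0) (hz : z ∈ D) (v : C3) (i : Fin 2) :
    pd i (fun w => frameConj R u ρ w v) z = 0 := by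
  have hu := h.differentiableAt_conformal hz
  have hl := (h.confFactor_pos z).ne'
  have hE := h.differentiableAt_tangentVec hz
  have hρ := h.differentiableAt hz
  have hi : ∀ {f : ℂ → C3}, DifferentiableAt ℝ f z →
      DifferentiableAt ℝ (fun w => inner ℂ v (f w)) z :=
    fun hf => (differentiableAt_const v).inner ℂ hf
  have hpi : ∀ {f : ℂ → C3}, DifferentiableAt ℝ f z →
      pd i (fun w => inner ℂ v (f w)) z = inner ℂ v (pd i f z) := by
    intro f hf
    rw [pd_inner (differentiableAt_const v) hf, pd_const, inner_zero_left, add_zero]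
  -- The inverse of L is written as e^{-u}/(2R²), so that it is differentiated as an exponential.
  have hLd : DifferentiableAt ℝ (fun w => Real.exp (-u w) * (2 * R ^ 2)⁻¹) z := by fun_prop
  have hLd' : DifferentiableAt ℝ (fun w => ((Real.exp (-u w) * (2 * R ^ 2)⁻¹ : ℝ) : ℂ)) z :=
    Complex.ofRealCLM.differentiableAt.comp z hLd
  have hLp : pd i (fun w => Real.exp (-u w) * (2 * R ^ 2)⁻¹) z
      = -(pd i u z * (2 * R ^ 2 * Real.exp (u z))⁻¹) := by
    rw [pd_mul (by fun_prop) (by fun_prop), pd_const, pd_exp (by fun_prop), pd_neg, Real.exp_neg,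
      mul_inv (2 * R ^ 2)]
    ring
  have hLe : ∀ w, (((2 * R ^ 2 * Real.exp (u w) : ℝ) : ℂ))⁻¹
      = ((Real.exp (-u w) * (2 * R ^ 2)⁻¹ : ℝ) : ℂ) := by
    intro w
    rw [← Complex.ofReal_inv, mul_inv, Real.exp_neg, mul_comm]
  have hd : ∀ k, DifferentiableAt ℝ (fun w =>
      ((Real.exp (-u w) * (2 * R ^ 2)⁻¹ : ℝ) : ℂ) • (inner ℂ v (tangentVec ρ k w)
        • tangentVec ρ k w)) z :=
    fun k => hLd'.smul ((hi (hE k)).smul (hE k))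
  have hd' : DifferentiableAt ℝ (fun w => ((((R ^ 2 : ℝ) : ℂ)⁻¹ * inner ℂ v (ρ w)) • ρ w)) z :=
    ((hi hρ).const_mul _).smul hρ
  have e : (fun w => frameConj R u ρ w v) = fun w =>
      (((Real.exp (-u w) * (2 * R ^ 2)⁻¹ : ℝ) : ℂ) • (inner ℂ v (tangentVec ρ 0 w)
          • tangentVec ρ 0 w)
        + ((Real.exp (-u w) * (2 * R ^ 2)⁻¹ : ℝ) : ℂ) • (inner ℂ v (tangentVec ρ 1 w)
          • tangentVec ρ 1 w))
        + ((((R ^ 2 : ℝ) : ℂ)⁻¹ * inner ℂ v (ρ w)) • ρ w) := by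
    funext w
    simp only [frameConj, Fin.sum_univ_two, hLe, smul_smul]
  have hcp : pd i (fun w => ((R ^ 2 : ℝ) : ℂ)⁻¹ * inner ℂ v (ρ w)) z
      = ((R ^ 2 : ℝ) : ℂ)⁻¹ * inner ℂ v (tangentVec ρ i z) := by
    have := pd_clm_comp ((ContinuousLinearMap.mul ℝ ℂ) ((R ^ 2 : ℝ) : ℂ)⁻¹) (hi hρ) i
    simp only [ContinuousLinearMap.mul_apply', hpi hρ] at this
    exact this
  -- With T = 0 the structure equations have real coefficients; this is why the conjugation is
  -- parallel.
  have hframe : ∀ j, pd i (tangentVec ρ j) z =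
      (∑ k, ((christoffel (confMetric R u) k i j z : ℝ) : ℂ) • tangentVec ρ k z)
        - (((R ^ 2 : ℝ) : ℂ)⁻¹ * (if i = j then ((2 * R ^ 2 * Real.exp (u z) : ℝ) : ℂ) else 0))
          • ρ z := by
    intro j
    conv_lhs => rw [h.eq_sum hz (pd i (tangentVec ρ j) z)]
    simp only [h.inner_tangentVec_pd hz, h.inner_self_pd_tangentVec hz, hT z hz, Complex.ofReal_zero,
      mul_zero, add_zero, inv_mul_cancel_left₀ (Complex.ofReal_ne_zero.2 hl)]
    split_ifs
    · module
    · module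
  rw [e, pd_add ((hd 0).fun_add (hd 1)) hd', pd_add (hd 0) (hd 1),
    pd_complex_smul hLd' ((hi (hE 0)).fun_smul (hE 0)), pd_complex_smul hLd' ((hi (hE 1)).fun_smul (hE 1)),
    pd_complex_smul (hi (hE 0)) (hE 0), pd_complex_smul (hi (hE 1)) (hE 1),
    pd_complex_smul ((hi hρ).const_mul _) hρ, hcp, pd_ofReal hLd, hLp, ← hLe,
    hpi (hE 0), hpi (hE 1), hframe, hframe]
  change _ + (_ • tangentVec ρ i z + _) = 0
  have hl' := Complex.ofReal_ne_zero.2 hl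
  have hR' := Complex.ofReal_ne_zero.2 (pow_pos h.pos 2).ne'
  simp only [christoffel_confMetric h.pos.ne' hu, Complex.ofReal_neg, Complex.ofReal_mul (pd i u z),
    Complex.ofReal_inv, Fin.sum_univ_two, inner_add_right, inner_sub_right, inner_smul_right]
  generalize ((2 * R ^ 2 * Real.exp (u z) : ℝ) : ℂ) = L at hl'
  generalize ((R ^ 2 : ℝ) : ℂ) = Q at hR'
  fin_cases i <;> simp <;> match_scalars <;> field_simp <;> ring

end IsMinimalChart

end RealSpan

/-! ### From charts to surfaces: the cone over the immersion and its real span -/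

section Surface

variable {T : Type*} [TopologicalSpace T] [ChartedSpace ℂ T] {R : ℝ} {r : T → C3}

theorem IsLocalParam.mdifferentiableAt {φ : ℂ → T} {D : Set ℂ} (h : IsLocalParam φ D) {z : ℂ}
    (hz : z ∈ D) : MDifferentiableAt 𝓘(ℝ, ℂ) 𝓘(ℝ, ℂ) φ z :=
  (h.localDiffeo ⟨z, hz⟩).mdifferentiableAt (by simp)

/-- The differential of a map of a surface into `ℂ³`. -/
noncomputable def surfaceDiff (r : T → C3) (x : T) : ℂ →L[ℝ] C3 := mfderiv 𝓘(ℝ, ℂ) 𝓘(ℝ, C3) r x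

/-- The differential of a parametrization of a surface. -/
noncomputable def paramDiff (φ : ℂ → T) (z : ℂ) : ℂ →L[ℝ] ℂ := mfderiv 𝓘(ℝ, ℂ) 𝓘(ℝ, ℂ) φ z

theorem IsLocalParam.surjective_paramDiff {φ : ℂ → T} {D : Set ℂ} (h : IsLocalParam φ D) {z : ℂ}
    (hz : z ∈ D) : Function.Surjective (paramDiff φ z) :=
  ((h.localDiffeo ⟨z, hz⟩).mfderivToContinuousLinearEquiv (by simp)).surjective

theorem IsComplexlyNormalImmersion.fderiv_comp (hr : IsComplexlyNormalImmersion R r) {φ : ℂ → T}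
    {D : Set ℂ} (h : IsLocalParam φ D) {z : ℂ} (hz : z ∈ D) (v : ℂ) :
    fderiv ℝ (r ∘ φ) z v =
      surfaceDiff r (φ z) (paramDiff φ z v) := by
  rw [← mfderiv_eq_fderiv, mfderiv_comp z ((hr.smooth (φ z)).mdifferentiableAt (by simp))
    (h.mdifferentiableAt hz)]
  rfl

theorem IsComplexlyNormalImmersion.contDiffOn_comp (hr : IsComplexlyNormalImmersion R r)
    {φ : ℂ → T} {D : Set ℂ} (h : IsLocalParam φ D) : ContDiffOn ℝ ∞ (r ∘ φ) D :=
  (hr.smooth.comp_contMDiffOn h.localDiffeo.contMDiffOn).contDiffOn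

theorem IsComplexlyNormalImmersion.inner_mfderiv (hr : IsComplexlyNormalImmersion R r)
    (hR : 0 < R) (x : T) (v : ℂ) : inner ℂ (surfaceDiff r x v) (r x) = 0 := by
  have h1 : inner ℂ (surfaceDiff r x v) (R⁻¹ • r x) = 0 := hr.normal x v
  rw [← Complex.coe_smul, inner_smul_right] at h1
  exact (mul_eq_zero.1 h1).resolve_left (Complex.ofReal_ne_zero.2 (inv_ne_zero hR.ne'))

theorem IsComplexlyNormalImmersion.isMinimalChart (hr : IsComplexlyNormalImmersion R r)
    (hR : 0 < R) (hH : HasZeroMeanCurvature r) {φ : ℂ → T} {D : Set ℂ} {u : ℂ → ℝ}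
    (h : IsIsothermal R r φ D u) : IsMinimalChart R u (r ∘ φ) D where
  pos := hR
  isOpen := h.param.isOpen
  smooth := hr.contDiffOn_comp h.param
  norm_eq z _ := hr.mem_sphere (φ z)
  normal z hz i := by
    rw [tangentVec, pd, hr.fderiv_comp h.param hz]
    exact hr.inner_mfderiv hR _ _
  metric := h.metric
  minimal := hH φ D h.param

/-- The differential `(s, v) ↦ s r(x) + dr(v)` of the cone `t r(x)` over the surface at `t = 1`. -/
noncomputable def coneDiff (r : T → C3) (x : T) : ℝ × ℂ →L[ℝ] C3 :=
  (ContinuousLinearMap.toSpanSingleton ℝ (r x)).coprod (surfaceDiff r x)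

theorem coneDiff_apply (r : T → C3) (x : T) (s : ℝ) (v : ℂ) :
    coneDiff r x (s, v) = s • r x + surfaceDiff r x v := by
  simp [coneDiff]

/-- The real span of the position vector and the tangent plane. -/
noncomputable def coneSpan (r : T → C3) (x : T) : Submodule ℝ C3 := LinearMap.range (coneDiff r x).toLinearMap

/-- Pairing with r removes the tangential part by complex normality and gives s = 0; then v = 0
because r is an immersion. -/
theorem IsComplexlyNormalImmersion.finrank_coneSpan (hr : IsComplexlyNormalImmersion R r)
    (hR : 0 < R) (x : T) : Module.finrank ℝ (coneSpan r x) = 3 := by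
  rw [coneSpan, LinearMap.finrank_range_of_inj]
  · simp
  · rw [← LinearMap.ker_eq_bot, LinearMap.ker_eq_bot']
    rintro ⟨s, v⟩ h
    rw [ContinuousLinearMap.coe_coe, coneDiff_apply] at h
    have h1 := congrArg (fun w => inner ℂ w (r x)) h
    simp only [inner_add_left, inner_zero_left, ← Complex.coe_smul, inner_smul_left,
      hr.inner_mfderiv hR x v] at h1
    rw [inner_self_eq_norm_sq_to_K, hr.mem_sphere] at h1
    have hs : s = 0 := by simpa [hR.ne'] using h1
    subst hs
    rw [zero_smul, zero_add] at h
    have hv : v = 0 := hr.immersion x (h.trans (map_zero _).symm)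
    rw [hv]; rfl

theorem mem_coneSpan_self (r : T → C3) (x : T) : r x ∈ coneSpan r x :=
  ⟨(1, 0), by rw [ContinuousLinearMap.coe_coe, coneDiff_apply, one_smul, map_zero, add_zero]⟩

theorem IsComplexlyNormalImmersion.mem_coneSpan_iff (hr : IsComplexlyNormalImmersion R r)
    {φ : ℂ → T} {D : Set ℂ} (h : IsLocalParam φ D) {z : ℂ} (hz : z ∈ D) (v : C3) :
    v ∈ coneSpan r (φ z) ↔
      ∃ (t : ℝ) (a : ℂ), v = t • (r ∘ φ) z + fderiv ℝ (r ∘ φ) z a := by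
  constructor
  · rintro ⟨⟨t, b⟩, rfl⟩
    obtain ⟨a, rfl⟩ := h.surjective_paramDiff hz b
    exact ⟨t, a, by rw [ContinuousLinearMap.coe_coe, coneDiff_apply, hr.fderiv_comp h hz]; rfl⟩
  · rintro ⟨t, a, rfl⟩
    refine ⟨(t, paramDiff φ z a), ?_⟩
    rw [ContinuousLinearMap.coe_coe, coneDiff_apply, hr.fderiv_comp h hz]; rfl

theorem IsLocalParam.map_nhds {φ : ℂ → T} {D : Set ℂ} (h : IsLocalParam φ D) {z : ℂ}
    (hz : z ∈ D) : Filter.map φ (nhds z) = nhds (φ z) :=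
  h.localDiffeo.isLocalHomeomorphOn.map_nhds_eq hz

/-- G = 0 forces T = 0, so the frame conjugation is constant on a ball in the chart, and `coneSpan`
is its fixed space. The parametrization carries neighbourhoods to neighbourhoods. -/
theorem IsComplexlyNormalImmersion.coneSpan_eventually_eq (hr : IsComplexlyNormalImmersion R r)
    (hR : 0 < R) (hH : HasZeroMeanCurvature r) {φ : ℂ → T} {D : Set ℂ} {u : ℂ → ℝ}
    (h : IsIsothermal R r φ D u) (hG : ∀ z ∈ D, cubicG (r ∘ φ) u z = 0) {z : ℂ} (hz : z ∈ D) :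
    ∀ᶠ y in nhds (φ z), coneSpan r y = coneSpan r (φ z) := by
  have hc := hr.isMinimalChart hR hH h
  have hT : ∀ w ∈ D, ∀ k i j, shapeTensor (r ∘ φ) k i j w = 0 := by
    intro w hw k i j
    have h1 := hG w hw
    rw [cubicG, mul_eq_zero] at h1
    have h2 := h1.resolve_left (Complex.ofReal_ne_zero.2 (Real.exp_ne_zero _))
    have hA := congrArg Complex.re h2
    have hB := congrArg Complex.im h2
    simp at hA hB
    rw [hc.shapeTensor_eq_traceFreeTensor hw]
    fin_cases k <;> fin_cases i <;> fin_cases j <;> simp [traceFreeTensor, hA, hB]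
  obtain ⟨ε, hε, hball⟩ := Metric.isOpen_iff.1 hc.isOpen z hz
  rw [← h.param.map_nhds hz, Filter.eventually_map]
  filter_upwards [Metric.ball_mem_nhds z hε] with w hw
  have hconst : ∀ v, frameConj R u (r ∘ φ) w v = frameConj R u (r ∘ φ) z v := by
    intro v
    exact Metric.isOpen_ball.is_const_of_fderiv_eq_zero (𝕜 := ℝ)
      (f := fun w => frameConj R u (r ∘ φ) w v) (convex_ball z ε).isPreconnected
      (fun y hy => (hc.differentiableAt_frameConj (hball hy) v).differentiableWithinAt)
      (fun y hy => fderiv_eq_zero_of_pd fun i => hc.pd_frameConj hT (hball hy) v i) hw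
      (Metric.mem_ball_self hε)
  ext v
  rw [hr.mem_coneSpan_iff h.param (hball hw), hr.mem_coneSpan_iff h.param hz,
    ← hc.frameConj_eq_self_iff (hball hw), ← hc.frameConj_eq_self_iff hz, hconst]

/-- The cone over a surface in a real three-dimensional subspace is open in this subspace at the
points at which the cone is regular. -/
theorem eventually_mem_cone {ρ : ℂ → C3} {z : ℂ} (hρ : ContDiffAt ℝ ∞ ρ z) {V : Submodule ℝ C3}
    (hV : ∀ v ∈ V, ∃ (t : ℝ) (a : ℂ), v = t • ρ z + fderiv ℝ ρ z a) (hρV : ∀ w, ρ w ∈ V) :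
    ∀ᶠ y in nhds (ρ z), y ∈ V → ∃ (t : ℝ) (w : ℂ), 0 < t ∧ t • ρ w = y := by
  -- A linear projection onto V makes V the target space. The cone map then has surjective
  -- differential at (1, z) and is open there.
  obtain ⟨P, hP⟩ := V.subtype.exists_leftInverse_of_injective (Submodule.ker_subtype V)
  have hP' : ∀ v (hv : v ∈ V), P v = ⟨v, hv⟩ := fun v hv => LinearMap.congr_fun hP ⟨v, hv⟩
  let Pc : C3 →L[ℝ] V := LinearMap.toContinuousLinearMap P
  have hPc : ∀ v (hv : v ∈ V), Pc v = ⟨v, hv⟩ := hP'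
  clear_value Pc
  have hΨ : HasStrictFDerivAt (fun q : ℝ × ℂ => Pc (q.1 • ρ q.2))
      (Pc.comp ((1 : ℝ) • (fderiv ℝ ρ z).comp (ContinuousLinearMap.snd ℝ ℝ ℂ) +
        (ContinuousLinearMap.fst ℝ ℝ ℂ).smulRight (ρ z))) ((1 : ℝ), z) := by
    have h1 : HasStrictFDerivAt (fun q : ℝ × ℂ => ρ q.2)
        ((fderiv ℝ ρ z).comp (ContinuousLinearMap.snd ℝ ℝ ℂ)) ((1 : ℝ), z) :=
      HasStrictFDerivAt.comp (g := ρ) ((1 : ℝ), z) (hρ.hasStrictFDerivAt (by simp))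
        hasStrictFDerivAt_snd
    have h2 := (hasStrictFDerivAt_fst (𝕜 := ℝ) (p := ((1 : ℝ), z))).fun_smul h1
    exact Pc.hasStrictFDerivAt.comp ((1 : ℝ), z) h2
  have hmap := hΨ.map_nhds_eq_of_surj (by
    rw [LinearMap.range_eq_top]
    rintro ⟨v, hv⟩
    obtain ⟨t, a, ha⟩ := hV v hv
    refine ⟨(t, a), ?_⟩
    rw [← hPc v hv, ContinuousLinearMap.coe_coe, ContinuousLinearMap.comp_apply, ha]
    congr 1
    simp [add_comm])
  -- Positivity of t is kept so that comparing norms on the sphere later forces t = 1.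
  have hN : {q : ℝ × ℂ | 0 < q.1} ∈ nhds ((1 : ℝ), z) :=
    (isOpen_lt continuous_const continuous_fst).mem_nhds (show (0 : ℝ) < 1 from one_pos)
  have him := Filter.image_mem_map (m := fun q : ℝ × ℂ => Pc (q.1 • ρ q.2)) hN
  rw [hmap] at him
  have hcont : Filter.Tendsto Pc (nhds (ρ z)) (nhds (Pc ((1 : ℝ) • ρ z))) := by
    rw [one_smul]
    exact Pc.continuous.continuousAt
  filter_upwards [hcont him] with y hy hyV
  obtain ⟨⟨t, w⟩, ht, hq⟩ := hy
  refine ⟨t, w, ht, ?_⟩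
  simp only [hPc _ (V.smul_mem t (hρV _)), hPc _ hyV, Subtype.mk.injEq] at hq
  exact hq

/-- If the surface lies in the real subspace spanned by the position vector and the tangent plane
at one of its points, then a neighbourhood of this point in the sphere of this subspace is covered
by the surface. -/
theorem IsComplexlyNormalImmersion.eventually_mem_range (hr : IsComplexlyNormalImmersion R r)
    (hR : 0 < R) {φ : ℂ → T} {D : Set ℂ} (h : IsLocalParam φ D) {z : ℂ} (hz : z ∈ D)
    {V : Submodule ℝ C3} (hV : coneSpan r (φ z) = V) (hrV : ∀ x, r x ∈ V) :
    ∀ᶠ y in nhds (r (φ z)), y ∈ V → ‖y‖ = R → y ∈ Set.range r := by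
  have hev := eventually_mem_cone (ρ := r ∘ φ)
    ((hr.contDiffOn_comp h).contDiffAt (h.isOpen.mem_nhds hz))
    (fun v hv => (hr.mem_coneSpan_iff h hz v).1 (hV ▸ hv)) (fun w => hrV (φ w))
  filter_upwards [hev] with y hy hyV hyR
  obtain ⟨t, w, ht, hq⟩ := hy hyV
  have ht' : t = 1 := by
    have h1 := congrArg norm hq
    rw [norm_smul, Function.comp_apply, hr.mem_sphere, hyR, Real.norm_of_nonneg ht.le] at h1
    exact mul_right_cancel₀ hR.ne' (h1.trans (one_mul R).symm)
  exact ⟨φ w, by rw [← hq, ht', one_smul]; rfl⟩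

/-- A minimal complexly normal surface with `G ≡ 0` is a piece of a great two-dimensional sphere. -/
theorem IsComplexlyNormalImmersion.exists_range_eq_of_cubicG_eq_zero [ConnectedSpace T]
    (hr : IsComplexlyNormalImmersion R r) (hR : 0 < R) (hH : HasZeroMeanCurvature r)
    (hG : ∀ x : T, ∃ (φ : ℂ → T) (D : Set ℂ) (u : ℂ → ℝ), IsIsothermal R r φ D u ∧ x ∈ φ '' D ∧
      ∀ z ∈ D, cubicG (r ∘ φ) u z = 0) :
    ∃ V : Submodule ℝ C3, Module.finrank ℝ V = 3 ∧
      ∃ U : Set C3, IsOpen U ∧ Set.range r = U ∩ ((V : Set C3) ∩ Metric.sphere 0 R) := by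
  have hloc : IsLocallyConstant (coneSpan r) := by
    rw [IsLocallyConstant.iff_eventually_eq]
    intro x
    obtain ⟨φ, D, u, h, ⟨z, hz, rfl⟩, hG0⟩ := hG x
    exact hr.coneSpan_eventually_eq hR hH h hG0 hz
  obtain ⟨x₀⟩ := (inferInstance : Nonempty T)
  have hV : ∀ x, coneSpan r x = coneSpan r x₀ := fun x => hloc.apply_eq_of_preconnectedSpace x x₀
  have hrV : ∀ x, r x ∈ coneSpan r x₀ := fun x => hV x ▸ mem_coneSpan_self r x
  -- The open set is the interior of the set where membership in V ∩ S_R implies membership in the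
  -- image. One inclusion is then immediate and the other is the local covering statement
  -- `eventually_mem_range`.
  refine ⟨coneSpan r x₀, hr.finrank_coneSpan hR x₀,
    interior {y | y ∈ coneSpan r x₀ → ‖y‖ = R → y ∈ Set.range r}, isOpen_interior, ?_⟩
  apply Set.Subset.antisymm
  · rintro _ ⟨x, rfl⟩
    refine ⟨?_, hrV x, by simpa using hr.mem_sphere x⟩
    obtain ⟨φ, D, u, h, ⟨z, hz, rfl⟩, -⟩ := hG x
    rw [mem_interior_iff_mem_nhds]
    exact hr.eventually_mem_range hR h.param hz (hV _) hrV
  · rintro y ⟨hy, hyV, hyR⟩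
    exact interior_subset hy hyV (by simpa using hyR)

end Surface

/-! ### Scalar invariants -/

section Invariants

variable {R : ℝ} {u A B : ℂ → ℝ}

/-- Four of the eight components are ±A and four are ±B. Three inverse metrics and two lowerings
leave one factor 1/L. -/
theorem invariantK_confMetric (hR : R ≠ 0) (z : ℂ) :
    invariantK (confMetric R u) (traceFreeTensor A B) z =
      4 * (A z ^ 2 + B z ^ 2) / (2 * R ^ 2 * Real.exp (u z)) := by
  have hl := (confFactor_pos hR u z).ne'
  simp only [invariantK, inv_confMetric_apply hR, lowerIndex_confMetric]
  generalize 2 * R ^ 2 * Real.exp (u z) = L at hl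
  simp [Fin.sum_univ_two, traceFreeTensor]
  field_simp
  ring

theorem raiseTwo_confMetric (hR : R ≠ 0) (t : Tensor3) (j k s : Fin 2) (z : ℂ) :
    raiseTwo (confMetric R u) t j k s z = (2 * R ^ 2 * Real.exp (u z))⁻¹ * t j k s z := by
  have hl := (confFactor_pos hR u z).ne'
  simp only [raiseTwo, inv_confMetric_apply hR, lowerIndex_confMetric]
  generalize 2 * R ^ 2 * Real.exp (u z) = L at hl
  simp
  field_simp

/-- The matrix Tⁱⱼₖ T^{jk}ₛ is 2(A² + B²)/L times the identity, and q is the trace of its square. -/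
theorem invariantQ_confMetric (hR : R ≠ 0) (z : ℂ) :
    invariantQ (confMetric R u) (traceFreeTensor A B) z =
      8 * (A z ^ 2 + B z ^ 2) ^ 2 / (2 * R ^ 2 * Real.exp (u z)) ^ 2 := by
  have hl := (confFactor_pos hR u z).ne'
  simp only [invariantQ, raiseTwo_confMetric hR]
  generalize 2 * R ^ 2 * Real.exp (u z) = L at hl
  simp [Fin.sum_univ_two, traceFreeTensor]
  field_simp
  ring

end Invariants

/-! ### Tori -/

section Torus

variable {R : ℝ} {u : ℂ → ℝ} {ρ : ℂ → C3} {D : Set ℂ}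

theorem exists_eq_fract_add {ω₁ ω₂ : ℂ} (h : LinearIndependent ℝ ![ω₁, ω₂]) (z : ℂ) :
    ∃ s ∈ Set.Icc (0 : ℝ) 1, ∃ t ∈ Set.Icc (0 : ℝ) 1, ∃ m n : ℤ,
      z = (s * ω₁ + t * ω₂) + (m * ω₁ + n * ω₂) := by
  have hs := h.span_eq_top_of_card_eq_finrank (by simp)
  have hz : z ∈ Submodule.span ℝ (Set.range ![ω₁, ω₂]) := hs ▸ Submodule.mem_top
  rw [Matrix.range_cons, Matrix.range_cons, Matrix.range_empty, Set.union_empty,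
    Set.singleton_union, Submodule.mem_span_pair] at hz
  obtain ⟨a, b, rfl⟩ := hz
  refine ⟨Int.fract a, ⟨Int.fract_nonneg a, (Int.fract_lt_one a).le⟩,
    Int.fract b, ⟨Int.fract_nonneg b, (Int.fract_lt_one b).le⟩, ⌊a⌋, ⌊b⌋, ?_⟩
  have e : ∀ x : ℝ, (x : ℂ) = ((Int.fract x : ℝ) : ℂ) + (⌊x⌋ : ℂ) := by
    intro x
    exact_mod_cast (Int.fract_add_floor x).symm
  rw [Complex.real_smul, Complex.real_smul]
  conv_lhs => rw [e a, e b]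
  ring

/-- A doubly periodic entire function is constant. -/
theorem Differentiable.apply_eq_apply_of_doubly_periodic {f : ℂ → ℂ} (hf : Differentiable ℂ f)
    {ω₁ ω₂ : ℂ} (h : LinearIndependent ℝ ![ω₁, ω₂])
    (hp : ∀ (z : ℂ) (m n : ℤ), f (z + (m * ω₁ + n * ω₂)) = f z) (z w : ℂ) : f z = f w := by
  refine hf.apply_eq_apply_of_bounded ?_ z w
  have hK : IsCompact ((fun q : ℝ × ℝ => f (q.1 * ω₁ + q.2 * ω₂)) ''
      (Set.Icc (0 : ℝ) 1 ×ˢ Set.Icc (0 : ℝ) 1)) := by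
    refine (isCompact_Icc.prod isCompact_Icc).image (hf.continuous.comp ?_)
    fun_prop
  refine hK.isBounded.subset ?_
  rintro _ ⟨z, rfl⟩
  obtain ⟨s, hs, t, ht, m, n, rfl⟩ := exists_eq_fract_add h z
  exact ⟨(s, t), ⟨hs, ht⟩, (hp _ m n).symm⟩

theorem pd_periodic {F : Type*} [NormedAddCommGroup F] [NormedSpace ℝ F] {f : ℂ → F} {a : ℂ}
    (hf : ∀ z, f (z + a) = f z) (i : Fin 2) (z : ℂ) : pd i f (z + a) = pd i f z := by
  rw [← pd_comp_add_right]
  simp only [hf]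

/-- The factor u is determined by the induced metric, so it inherits the periods of ρ without any
assumption on u. -/
theorem IsMinimalChart.conformal_periodic (h : IsMinimalChart R u ρ Set.univ) {a : ℂ}
    (ha : ∀ z, ρ (z + a) = ρ z) (z : ℂ) : u (z + a) = u z := by
  have h1 := h.inner_tangentVec (Set.mem_univ (z + a)) 0 0
  have h2 := h.inner_tangentVec (Set.mem_univ z) 0 0
  have hE : tangentVec ρ 0 (z + a) = tangentVec ρ 0 z := pd_periodic ha 0 z
  rw [hE, h2] at h1
  simp only [if_true] at h1
  have h3 := Complex.ofReal_injective h1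
  have hR := h.pos
  exact (Real.exp_injective (mul_left_cancel₀ (by positivity) h3)).symm

theorem IsMinimalChart.cubicG_periodic (h : IsMinimalChart R u ρ Set.univ) {a : ℂ}
    (ha : ∀ z, ρ (z + a) = ρ z) (z : ℂ) : cubicG ρ u (z + a) = cubicG ρ u z := by
  have hE : ∀ i z, tangentVec ρ i (z + a) = tangentVec ρ i z := fun i z => pd_periodic ha i z
  have hE' : ∀ i j z, pd i (tangentVec ρ j) (z + a) = pd i (tangentVec ρ j) z :=
    fun i j z => pd_periodic (hE j) i z
  simp only [cubicG, h.shapeTensor_eq (Set.mem_univ _), h.conformal_periodic ha, hE, hE']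

theorem tangentVec_comp_real_mul (ρ : ℂ → C3) (c : ℝ) (i : Fin 2) (z : ℂ) :
    tangentVec (fun w => ρ (c * w)) i z = c • tangentVec ρ i (c * z) :=
  pd_comp_real_mul ρ c i z

theorem exp_add_two_mul_log {c : ℝ} (hc : 0 < c) (x : ℝ) :
    Real.exp (x + 2 * Real.log c) = c ^ 2 * Real.exp x := by
  rw [Real.exp_add, two_mul, Real.exp_add, Real.exp_log hc]; ring

theorem inducedMetric_comp_real_mul (h : IsMinimalChart R u ρ Set.univ) {c : ℝ} (hc : 0 < c)
    (z : ℂ) : inducedMetric (fun w => ρ (c * w)) z =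
      confMetric R (fun w => u (c * w) + 2 * Real.log c) z := by
  ext i j
  rw [confMetric_apply, exp_add_two_mul_log hc, inducedMetric, Matrix.of_apply,
    tangentVec_comp_real_mul, tangentVec_comp_real_mul, ← Complex.coe_smul, ← Complex.coe_smul,
    inner_smul_left, inner_smul_right, h.inner_tangentVec (Set.mem_univ _), Complex.conj_ofReal,
    Complex.re_ofReal_mul, Complex.re_ofReal_mul]
  split_ifs
  · rw [Complex.ofReal_re]; ring
  · simp

/-- G transforms as the coefficient of a cubic differential: T acquires the factor c³/c² = c and eᵘ
the factor c². -/
theorem IsMinimalChart.cubicG_comp_real_mul (h : IsMinimalChart R u ρ Set.univ) {c : ℝ}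
    (hc : 0 < c)
    (h' : IsMinimalChart R (fun w => u (c * w) + 2 * Real.log c) (fun w => ρ (c * w)) Set.univ)
    (z : ℂ) : cubicG (fun w => ρ (c * w)) (fun w => u (c * w) + 2 * Real.log c) z =
      ((c ^ 3 : ℝ) : ℂ) * cubicG ρ u (c * z) := by
  have hE : ∀ j, tangentVec (fun w => ρ (c * w)) j = fun w => c • tangentVec ρ j (c * w) :=
    fun j => funext fun w => tangentVec_comp_real_mul ρ c j w
  have hp : ∀ i j, pd i (tangentVec (fun w => ρ (c * w)) j) z
      = (c * c) • pd i (tangentVec ρ j) (c * z) := by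
    intro i j
    rw [hE, pd_comp_real_mul (fun w => c • tangentVec ρ j w),
      pd_smul (differentiableAt_const c) (h.differentiableAt_tangentVec (Set.mem_univ _) j),
      pd_const, zero_smul, add_zero, mul_smul]
  have hT : ∀ k i j, shapeTensor (fun w => ρ (c * w)) k i j z = c * shapeTensor ρ k i j (c * z) := by
    intro k i j
    rw [h'.shapeTensor_eq (Set.mem_univ _), h.shapeTensor_eq (Set.mem_univ _), hp,
      tangentVec_comp_real_mul,
      ← Complex.coe_smul, ← Complex.coe_smul, inner_smul_left, inner_smul_right,
      exp_add_two_mul_log hc, Complex.conj_ofReal, Complex.im_ofReal_mul, Complex.im_ofReal_mul]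
    have := h.pos.ne'
    field_simp
  rw [cubicG, cubicG, hT, hT, exp_add_two_mul_log hc]
  push_cast
  ring

variable {T : Type*} [TopologicalSpace T] [ChartedSpace ℂ T] {r : T → C3} {p : ℂ → T}
  {ω₁ ω₂ : ℂ}

theorem IsTorusParam.apply_add (h : IsTorusParam R r p ω₁ ω₂ u) (z : ℂ) (m n : ℤ) :
    p (z + (m * ω₁ + n * ω₂)) = p z :=
  (h.fiber _ _).2 ⟨m, n, by ring⟩

theorem IsTorusParam.comp_real_mul (h : IsTorusParam R r p ω₁ ω₂ u)
    (hρ : IsMinimalChart R u (r ∘ p) Set.univ) {c : ℝ} (hc : 0 < c) :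
    IsTorusParam R r (fun z => p (c * z)) (ω₁ / c) (ω₂ / c)
      (fun z => u (c * z) + 2 * Real.log c) where
  isothermal := by
    refine ⟨⟨isOpen_univ, fun z => ?_⟩, fun z _ => inducedMetric_comp_real_mul hρ hc z⟩
    let e : ℂ ≃L[ℝ] ℂ := ContinuousLinearEquiv.smulLeft (Units.mk0 c hc.ne')
    have he : (fun z : ℂ => p (c * z)) = p ∘ e := by
      funext w
      simp [e, Units.smul_def]
    rw [he]
    exact IsLocalDiffeomorphAt.comp _ _ (e.toDiffeomorph.isLocalDiffeomorph z)
      (h.isothermal.param.localDiffeo ⟨e z, Set.mem_univ _⟩)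
  surjective := by
    intro x
    obtain ⟨z, rfl⟩ := h.surjective x
    have : (c : ℂ) ≠ 0 := Complex.ofReal_ne_zero.2 hc.ne'
    exact ⟨z / c, by simp only [mul_div_cancel₀ z this]⟩
  independent := by
    have h1 := h.independent.units_smul (fun _ => Units.mk0 c⁻¹ (inv_ne_zero hc.ne'))
    convert h1 using 1
    funext i
    fin_cases i <;> simp [Units.smul_def, div_eq_inv_mul]
  fiber z w := by
    have hc' : (c : ℂ) ≠ 0 := Complex.ofReal_ne_zero.2 hc.ne'
    rw [h.fiber]
    refine exists₂_congr fun m n => ?_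
    rw [← mul_sub]
    constructor
    · intro h1
      apply mul_left_cancel₀ hc'
      rw [h1]
      field_simp
    · intro h1
      rw [h1]
      field_simp

theorem IsTorusParam.cubicG_eq (h : IsTorusParam R r p ω₁ ω₂ u)
    (hρ : IsMinimalChart R u (r ∘ p) Set.univ) (z w : ℂ) :
    cubicG (r ∘ p) u z = cubicG (r ∘ p) u w := by
  have hd : Differentiable ℂ (cubicG (r ∘ p) u) :=
    differentiableOn_univ.1 hρ.differentiableOn_cubicG
  refine hd.apply_eq_apply_of_doubly_periodic h.independent (fun z m n => ?_) z w
  exact hρ.cubicG_periodic (fun z => by simp only [Function.comp_apply, h.apply_add]) z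

theorem wirtingerBar_wirtinger (hu : ContDiff ℝ ∞ u) (z : ℂ) :
    wirtingerBar (wirtinger fun w => (u w : ℂ)) z =
      (((pd 0 (pd 0 u) z + pd 1 (pd 1 u) z) / 4 : ℝ) : ℂ) := by
  have huo : ContDiffOn ℝ ∞ u Set.univ := hu.contDiffOn
  have hd : ∀ i, DifferentiableAt ℝ (pd i u) z := fun i =>
    (huo.pd isOpen_univ i).differentiableAt_of_isOpen isOpen_univ (Set.mem_univ z)
  have e : wirtinger (fun w => (u w : ℂ)) = fun w =>
      ((1 / 2 * pd 0 u w : ℝ) : ℂ) + Complex.I * ((-(1 / 2) * pd 1 u w : ℝ) : ℂ) := by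
    funext w
    have huw := huo.differentiableAt_of_isOpen isOpen_univ (Set.mem_univ w)
    rw [wirtinger, pd_ofReal huw, pd_ofReal huw]
    push_cast
    ring
  rw [wirtingerBar, e, pd_ofReal_add_I_mul ((hd 0).const_mul _) ((hd 1).const_mul _),
    pd_ofReal_add_I_mul ((hd 0).const_mul _) ((hd 1).const_mul _), pd_const_mul _ (hd 0),
    pd_const_mul _ (hd 1), pd_const_mul _ (hd 0), pd_const_mul _ (hd 1),
    pd_comm huo isOpen_univ 1 0 (Set.mem_univ z)]
  push_cast
  linear_combination (-(1 / 4) * ((pd 1 (pd 1 u) z : ℝ) : ℂ)) * Complex.I_sq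

theorem exists_pos_pow_three_mul_eq_one {x : ℝ} (hx : 0 < x) : ∃ c : ℝ, 0 < c ∧ c ^ 3 * x = 1 := by
  refine ⟨x⁻¹ ^ ((3 : ℕ) : ℝ)⁻¹, by positivity, ?_⟩
  rw [Real.rpow_inv_natCast_pow (by positivity) (by norm_num), inv_mul_cancel₀ hx.ne']

theorem IsMinimalChart.shapeTensor_of_cubicG_eq (h : IsMinimalChart R u ρ D) {ϑ : ℝ} {z : ℂ}
    (hz : z ∈ D) (hG : cubicG ρ u z = (Real.cos ϑ : ℂ) + Complex.I * (Real.sin ϑ : ℂ))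
    (k i j : Fin 2) :
    shapeTensor ρ k i j z = traceFreeTensor (fun w => Real.exp (-u w) * Real.cos ϑ)
      (fun w => Real.exp (-u w) * Real.sin ϑ) k i j z := by
  have hA : Real.exp (u z) * shapeTensor ρ 0 0 0 z = Real.cos ϑ := by
    have := congrArg Complex.re hG
    rw [cubicG, Complex.re_ofReal_mul] at this
    simpa only [Complex.add_re, Complex.ofReal_re, Complex.re_mul_ofReal, Complex.I_re, zero_mul,
      add_zero] using this
  have hB : Real.exp (u z) * shapeTensor ρ 1 1 1 z = Real.sin ϑ := by
    have := congrArg Complex.im hG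
    rw [cubicG, Complex.im_ofReal_mul] at this
    simpa only [Complex.add_im, Complex.ofReal_im, Complex.im_mul_ofReal, Complex.I_im, one_mul,
      zero_add] using this
  rw [h.shapeTensor_eq_traceFreeTensor hz]
  have hA' : Real.exp (-u z) * Real.cos ϑ = shapeTensor ρ 0 0 0 z := by
    rw [← hA, ← mul_assoc, ← Real.exp_add, neg_add_cancel, Real.exp_zero, one_mul]
  have hB' : Real.exp (-u z) * Real.sin ϑ = shapeTensor ρ 1 1 1 z := by
    rw [← hB, ← mul_assoc, ← Real.exp_add, neg_add_cancel, Real.exp_zero, one_mul]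
  simp only [traceFreeTensor, hA', hB']

theorem exp_mul_cos_sq_add_exp_mul_sin_sq (x ϑ : ℝ) :
    (Real.exp (-x) * Real.cos ϑ) ^ 2 + (Real.exp (-x) * Real.sin ϑ) ^ 2 = Real.exp (-2 * x) := by
  rw [show -2 * x = -x + -x by ring, Real.exp_add]
  linear_combination Real.exp (-x) ^ 2 * Real.sin_sq_add_cos_sq ϑ

theorem four_mul_div_exp (hR : R ≠ 0) (x : ℝ) :
    4 * Real.exp (-2 * x) / (2 * R ^ 2 * Real.exp x) = 2 * Real.exp (-3 * x) / R ^ 2 := by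
  rw [show -3 * x = -2 * x - x by ring, Real.exp_sub]
  field_simp
  ring

theorem eight_mul_div_exp (hR : R ≠ 0) (x : ℝ) :
    8 * Real.exp (-2 * x) ^ 2 / (2 * R ^ 2 * Real.exp x) ^ 2 = 2 * Real.exp (-6 * x) / R ^ 4 := by
  rw [show -6 * x = (-2 * x + -2 * x) - (x + x) by ring, Real.exp_sub, Real.exp_add, Real.exp_add]
  field_simp
  ring

end Torus

/-! ### Assembly of the local, spherical and toroidal statements -/

theorem mainTheorem1 {T : Type*} [TopologicalSpace T] [ConnectedSpace T] [ChartedSpace ℂ T]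
    [IsManifold 𝓘(ℝ, ℂ) ∞ T] (R : ℝ) (hR : 0 < R) (r : T → C3)
    (hr : IsComplexlyNormalImmersion R r) (hH : HasZeroMeanCurvature r) :
    -- isothermal coordinates: moving frame equations, form of the tensor, holomorphy of `G`
    (∀ (φ : ℂ → T) (D : Set ℂ) (u : ℂ → ℝ), IsIsothermal R r φ D u →
      (∀ z ∈ D, ∀ k, complVec (r ∘ φ) k z = Complex.I • tangentVec (r ∘ φ) k z) ∧
      (∀ z ∈ D, ∀ i j, pd i (tangentVec (r ∘ φ) j) z =
        (∑ k, christoffel (inducedMetric (r ∘ φ)) k i j z • tangentVec (r ∘ φ) k z)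
          + (∑ k, shapeTensor (r ∘ φ) k i j z • complVec (r ∘ φ) k z)
          - (R⁻¹ * inducedMetric (r ∘ φ) z i j) • (R⁻¹ • r (φ z))) ∧
      (∀ z ∈ D, ∀ k i j, shapeTensor (r ∘ φ) k i j z =
        traceFreeTensor (shapeTensor (r ∘ φ) 0 0 0) (shapeTensor (r ∘ φ) 1 1 1) k i j z) ∧
      CodazziRicciEq (inducedMetric (r ∘ φ)) (shapeTensor (r ∘ φ)) D ∧
      GaussEq R (inducedMetric (r ∘ φ)) (shapeTensor (r ∘ φ)) D ∧
      DifferentiableOn ℂ (cubicG (r ∘ φ) u) D) ∧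
    -- the Peterson–Codazzi–Ricci equations are the Cauchy–Riemann equations for `G`
    (∀ (D : Set ℂ) (u A B : ℂ → ℝ), IsOpen D →
      ContDiffOn ℝ ∞ u D → ContDiffOn ℝ ∞ A D → ContDiffOn ℝ ∞ B D →
      (CodazziRicciEq (confMetric R u) (traceFreeTensor A B) D ↔
        ∀ z ∈ D,
          pd 0 (fun w => Real.exp (u w) * A w) z = pd 1 (fun w => Real.exp (u w) * B w) z ∧
          pd 1 (fun w => Real.exp (u w) * A w) z = -pd 0 (fun w => Real.exp (u w) * B w) z) ∧
      (CodazziRicciEq (confMetric R u) (traceFreeTensor A B) D ↔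
        DifferentiableOn ℂ
          (fun z => (Real.exp (u z) : ℂ) * ((A z : ℂ) + Complex.I * (B z : ℂ))) D)) ∧
    -- `G ≡ 0`: a piece of a great two-dimensional sphere
    ((∀ x : T, ∃ (φ : ℂ → T) (D : Set ℂ) (u : ℂ → ℝ), IsIsothermal R r φ D u ∧ x ∈ φ '' D ∧
        ∀ z ∈ D, cubicG (r ∘ φ) u z = 0) →
      ∃ V : Submodule ℝ C3, Module.finrank ℝ V = 3 ∧
        ∃ U : Set C3, IsOpen U ∧ Set.range r = U ∩ ((V : Set C3) ∩ Metric.sphere 0 R)) ∧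
    -- tori with `G ≢ 0`
    (∀ (p : ℂ → T) (ω₁ ω₂ : ℂ) (u : ℂ → ℝ), IsTorusParam R r p ω₁ ω₂ u →
      (∃ z, cubicG (r ∘ p) u z ≠ 0) →
      (∃ G₀ : ℂ, G₀ ≠ 0 ∧ ∀ z, cubicG (r ∘ p) u z = G₀) ∧
      (∃ c : ℝ, 0 < c ∧
        IsTorusParam R r (fun z => p (c * z)) (ω₁ / c) (ω₂ / c)
          (fun z => u (c * z) + 2 * Real.log c) ∧
        ∀ z, ‖cubicG (r ∘ fun w => p (c * w)) (fun w => u (c * w) + 2 * Real.log c) z‖ = 1) ∧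
      ((∀ z, ‖cubicG (r ∘ p) u z‖ = 1) →
        ∃ ϑ : ℝ,
          (∀ z, cubicG (r ∘ p) u z = (Real.cos ϑ : ℂ) + Complex.I * (Real.sin ϑ : ℂ)) ∧
          (∀ z k i j, shapeTensor (r ∘ p) k i j z =
            traceFreeTensor (fun w => Real.exp (-u w) * Real.cos ϑ)
              (fun w => Real.exp (-u w) * Real.sin ϑ) k i j z) ∧
          (∀ z, invariantK (inducedMetric (r ∘ p)) (shapeTensor (r ∘ p)) z =
            2 * Real.exp (-3 * u z) / R ^ 2) ∧
          (∀ z, invariantQ (inducedMetric (r ∘ p)) (shapeTensor (r ∘ p)) z =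
            2 * Real.exp (-6 * u z) / R ^ 4) ∧
          ContDiff ℝ ∞ u ∧
          (∀ z (m n : ℤ), u (z + (m * ω₁ + n * ω₂)) = u z) ∧
          (∀ z, pd 0 (pd 0 u) z + pd 1 (pd 1 u) z =
            4 * Real.exp (-2 * u z) - 4 * Real.exp (u z)) ∧
          (∀ z, wirtingerBar (wirtinger fun w => (u w : ℂ)) z =
            (Real.exp (-2 * u z) : ℂ) - (Real.exp (u z) : ℂ)))) ∧
    -- for a tensor of this form the Gauss equation is the Tzitzeica equation
    (∀ (D : Set ℂ) (u : ℂ → ℝ) (ϑ : ℝ), IsOpen D → ContDiffOn ℝ ∞ u D →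
      (GaussEq R (confMetric R u)
          (traceFreeTensor (fun w => Real.exp (-u w) * Real.cos ϑ)
            (fun w => Real.exp (-u w) * Real.sin ϑ)) D ↔
        ∀ z ∈ D, pd 0 (pd 0 u) z + pd 1 (pd 1 u) z =
          4 * Real.exp (-2 * u z) - 4 * Real.exp (u z))) := by
  refine ⟨fun φ D u h => ?_, fun D u A B hD hu hA hB => ?_,
    hr.exists_range_eq_of_cubicG_eq_zero hR hH, fun p ω₁ ω₂ u h hG => ?_, fun D u ϑ hD hu => ?_⟩
  · have hc := hr.isMinimalChart hR hH h
    exact ⟨fun z hz => hc.complVec_eq hz, fun z hz => hc.frame_eq hz,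
      fun z hz => hc.shapeTensor_eq_traceFreeTensor hz, hc.codazziRicciEq, hc.gaussEq,
      hc.differentiableOn_cubicG⟩
  · have hu' := fun z (hz : z ∈ D) => hu.differentiableAt_of_isOpen hD hz
    have hA' := fun z (hz : z ∈ D) => hA.differentiableAt_of_isOpen hD hz
    have hB' := fun z (hz : z ∈ D) => hB.differentiableAt_of_isOpen hD hz
    have hiff := codazziRicciEq_confMetric_iff hR.ne' hu' hA' hB'
    refine ⟨hiff, hiff.trans (forall₂_congr fun z hz => ?_)⟩
    have hud := hu' z hz
    have hAd := hA' z hz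
    have hBd := hB' z hz
    have e : (fun w => (Real.exp (u w) : ℂ) * ((A w : ℂ) + Complex.I * (B w : ℂ))) =
        fun w => ((Real.exp (u w) * A w : ℝ) : ℂ)
          + Complex.I * ((Real.exp (u w) * B w : ℝ) : ℂ) := by
      funext w
      push_cast
      ring
    rw [← differentiableAt_complex_iff_pd (by fun_prop) (by fun_prop), e]
    exact ⟨fun H => H.differentiableWithinAt, fun H => H.differentiableAt (hD.mem_nhds hz)⟩
  · have hc := hr.isMinimalChart hR hH h.isothermal
    obtain ⟨z₀, hz₀⟩ := hG
    have hconst : ∀ z, cubicG (r ∘ p) u z = cubicG (r ∘ p) u z₀ := fun z => h.cubicG_eq hc z z₀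
    refine ⟨⟨_, hz₀, hconst⟩, ?_, fun hn => ?_⟩
    · obtain ⟨c, hc0, hc1⟩ := exists_pos_pow_three_mul_eq_one (norm_pos_iff.2 hz₀)
      have h' := h.comp_real_mul hc hc0
      refine ⟨c, hc0, h', fun z => ?_⟩
      have := hc.cubicG_comp_real_mul hc0 (hr.isMinimalChart hR hH h'.isothermal) z
      change ‖cubicG (fun w => (r ∘ p) (c * w)) _ z‖ = 1
      rw [this, hconst, norm_mul, Complex.norm_real, Real.norm_of_nonneg (by positivity), hc1]
    · have hϑ : ∀ z, cubicG (r ∘ p) u z =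
          (Real.cos (cubicG (r ∘ p) u z₀).arg : ℂ)
            + Complex.I * (Real.sin (cubicG (r ∘ p) u z₀).arg : ℂ) := by
        intro z
        have h1 := Complex.norm_mul_exp_arg_mul_I (cubicG (r ∘ p) u z₀)
        rw [hn, Complex.ofReal_one, one_mul, Complex.exp_mul_I] at h1
        rw [hconst, Complex.ofReal_cos, Complex.ofReal_sin, mul_comm Complex.I]
        exact h1.symm
      generalize (cubicG (r ∘ p) u z₀).arg = ϑ at hϑ
      have hT := fun z => hc.shapeTensor_of_cubicG_eq (Set.mem_univ z) (hϑ z)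
      have hu : ContDiff ℝ ∞ u := contDiffOn_univ.1 hc.contDiffOn_conformal
      have hm := fun z => hc.metric z (Set.mem_univ z)
      have htz : ∀ z, pd 0 (pd 0 u) z + pd 1 (pd 1 u) z =
          4 * Real.exp (-2 * u z) - 4 * Real.exp (u z) := by
        intro z
        rw [hc.gauss_scalar (Set.mem_univ z), ← exp_mul_cos_sq_add_exp_mul_sin_sq (u z) ϑ, hT, hT]
        rfl
      refine ⟨ϑ, hϑ, hT, fun z => ?_, fun z => ?_, hu,
        fun z m n => hc.conformal_periodic
          (fun z => by simp only [Function.comp_apply, h.apply_add]) z, htz, fun z => ?_⟩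
      · have e : invariantK (inducedMetric (r ∘ p)) (shapeTensor (r ∘ p)) z =
            invariantK (confMetric R u) (traceFreeTensor (fun w => Real.exp (-u w) * Real.cos ϑ)
              (fun w => Real.exp (-u w) * Real.sin ϑ)) z := by
          simp only [invariantK, lowerIndex, hm, hT]
        rw [e, invariantK_confMetric hR.ne', exp_mul_cos_sq_add_exp_mul_sin_sq,
          four_mul_div_exp hR.ne']
      · have e : invariantQ (inducedMetric (r ∘ p)) (shapeTensor (r ∘ p)) z =
            invariantQ (confMetric R u) (traceFreeTensor (fun w => Real.exp (-u w) * Real.cos ϑ)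
              (fun w => Real.exp (-u w) * Real.sin ϑ)) z := by
          simp only [invariantQ, raiseTwo, lowerIndex, hm, hT]
        rw [e, invariantQ_confMetric hR.ne', exp_mul_cos_sq_add_exp_mul_sin_sq,
          eight_mul_div_exp hR.ne']
      · rw [wirtingerBar_wirtinger hu, htz, ← Complex.ofReal_sub]
        congr 1
        ring
  · rw [gaussEq_confMetric_iff hR.ne' hD hu]
    refine forall₂_congr fun z _ => ?_
    rw [exp_mul_cos_sq_add_exp_mul_sin_sq]
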